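/- A simplicial set with hollowness is a simplicial set $X$ together with, for each $m\ge 1$, a set of $m$-simplices of $X$, called hollow, containing all degenerate $m$-simplices ($0$-simplices are never hollow); a morphism is a simplicial map that preserves hollow simplices. For $m\ge 1$ and $0\le k\le m$, a horn $\Lambda^k[m]\to X$ is called admissible if it sends every simplex of $\Lambda^k[m]$ whose vertices include all of $\{k-1,k,k+1\}\cap\{0,\dots,m\}$ to a hollow simplex, and an $m$-simplex $x$ of $X$ is called $k$-admissible if every face of $x$ (including $x$ itself) whose vertices include all of $\{k-1,k,k+1\}\cap\{0,\dots,m\}$ is hollow. A weak Street $2$-category is a simplicial set with hollowness $X$ such that: (i) every admissible horn in $X$ has a hollow filler; (ii) if $x$ is a $k$-admissible simplex all of whose codimension-one faces $d_ix$ with $i\ne k$ are hollow, then $d_kx$ is hollow; (iii) the hollowness is saturated: no strictly larger choice of hollow simplices on the same simplicial set satisfies (i) and (ii); (iv) every simplex of dimension greater than $2$ is hollow, and admissible horns of dimension greater than $2$ have exactly one filler. It is doubly degenerate if it has exactly one $0$-simplex and exactly one $1$-simplex. Theorem. The category of doubly degenerate weak Street $2$-categories and hollowness-preserving simplicial maps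 is equivalent to the category of commutative monoids and monoid homomorphisms. -/

import Mathlib

open CategoryTheory Simplicial Opposite

universe u

namespace Street

/-- A hollowness structure (stratification) on a simplicial set: a choice of hollow simplices in
each positive dimension that includes all the degenerate simplices. -/
@[ext]
structure Hollowness (X : SSet.{u}) where
  hollow (m : ℕ) : Set (X _⦋m⦌)
  hollow_zero : hollow 0 = ∅
  degenerate_subset (m : ℕ) : X.degenerate m ⊆ hollow m

/-- The face `α` of the standard `m`-simplex contains those of the vertices `k - 1`, `k`, `k + 1`
that exist. -/
def ContainsNeighbours {m r : ℕ} (k : Fin (m + 1)) (α : ⦋r⦌ ⟶ ⦋m⦌) : Prop :=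
  ∀ j : Fin (m + 1), (j : ℕ) ≤ (k : ℕ) + 1 → (k : ℕ) ≤ (j : ℕ) + 1 → j ∈ Set.range α

namespace Hollowness

variable {X : SSet.{u}} (S : Hollowness X)

/-- A horn `Λ[m + 1, k] ⟶ X` is admissible if each of its simplices that contains the vertices
`k - 1`, `k`, `k + 1` (as far as these exist) is hollow. -/
def IsAdmissibleHorn {m : ℕ} {k : Fin (m + 2)} (f : (Λ[m + 1, k] : SSet.{u}) ⟶ X) : Prop :=
  ∀ (r : ℕ) (α : ⦋r⦌ ⟶ ⦋m + 1⦌)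
    (hα : SSet.stdSimplex.objEquiv.symm α ∈ (Λ[m + 1, k] : (Δ[m + 1] : SSet.{u}).Subcomplex).obj
      (op ⦋r⦌)),
    ContainsNeighbours k α → f.app (op ⦋r⦌) ⟨_, hα⟩ ∈ S.hollow r

/-- A simplex is `k`-admissible if each of its faces that contains the vertices `k - 1`, `k`,
`k + 1` (as far as these exist) is hollow; in particular, it is itself hollow. -/
def IsAdmissibleSimplex {m : ℕ} (k : Fin (m + 1)) (x : X _⦋m⦌) : Prop :=
  ∀ (r : ℕ) (α : ⦋r⦌ ⟶ ⦋m⦌), ContainsNeighbours k α → X.map α.op x ∈ S.hollow r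

/-- The simplex `x` restricts to the horn `f`. -/
def IsFiller {m : ℕ} {k : Fin (m + 2)} (f : (Λ[m + 1, k] : SSet.{u}) ⟶ X)
    (x : X _⦋m + 1⦌) : Prop :=
  (Λ[m + 1, k] : (Δ[m + 1] : SSet.{u}).Subcomplex).ι ≫ SSet.yonedaEquiv.symm x = f

/-- The existence of hollow fillers of admissible horns, and the closure of hollowness under
composition: if all the faces of an admissible simplex but the `k`-th are hollow, so is the
`k`-th. -/
structure IsComplicial : Prop where
  exists_filler {m : ℕ} {k : Fin (m + 2)} (f : (Λ[m + 1, k] : SSet.{u}) ⟶ X) :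
    S.IsAdmissibleHorn f → ∃ x ∈ S.hollow (m + 1), IsFiller f x
  face_hollow {m : ℕ} (k : Fin (m + 2)) (x : X _⦋m + 1⦌) :
    S.IsAdmissibleSimplex k x → (∀ i, i ≠ k → X.δ i x ∈ S.hollow m) → X.δ k x ∈ S.hollow m

/-- Street's weak `ω`-categories: hollow fillers exist, hollowness is closed under composition,
and hollowness is maximal with these properties, i.e. all equivalences are hollow. -/
structure IsWeakOmegaCategory : Prop extends S.IsComplicial where
  saturated (S' : Hollowness X) :
    S'.IsComplicial → (∀ m, S.hollow m ⊆ S'.hollow m) → ∀ m, S'.hollow m ⊆ S.hollow m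

/-- Street's weak `n`-categories: the weak `ω`-categories in which every simplex of dimension
greater than `n` is hollow, and admissible horns of dimension greater than `n` have only one
filler. -/
structure IsWeakCategory (n : ℕ) : Prop extends S.IsWeakOmegaCategory where
  hollow_of_lt (m : ℕ) (x : X _⦋m⦌) : n < m → x ∈ S.hollow m
  filler_unique {m : ℕ} {k : Fin (m + 2)} (f : (Λ[m + 1, k] : SSet.{u}) ⟶ X) :
    n < m + 1 → S.IsAdmissibleHorn f → ∀ x y : X _⦋m + 1⦌, IsFiller f x → IsFiller f y → x = y

end Hollowness

end Street

/-- Simplicial sets with hollowness (stratified simplicial sets). -/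
structure HollowSSet where
  toSSet : SSet.{u}
  hollowness : Street.Hollowness toSSet

namespace HollowSSet

/-- Simplicial maps that preserve hollow simplices. -/
@[ext]
structure Hom (X Y : HollowSSet.{u}) where
  map : X.toSSet ⟶ Y.toSSet
  map_hollow (m : ℕ) (x : X.toSSet _⦋m⦌) :
    x ∈ X.hollowness.hollow m → map.app (op ⦋m⦌) x ∈ Y.hollowness.hollow m

instance : Category HollowSSet.{u} where
  Hom := Hom
  id X := ⟨𝟙 X.toSSet, fun _ _ h => h⟩
  comp f g := ⟨f.map ≫ g.map, fun m x h => g.map_hollow m _ (f.map_hollow m x h)⟩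

/-- The weak Street `n`-categories. -/
def isWeakStreetCategory (n : ℕ) : ObjectProperty HollowSSet.{u} :=
  fun X => X.hollowness.IsWeakCategory n

/-- There is exactly one `0`-cell and exactly one `1`-cell. -/
def isDoublyDegenerate : ObjectProperty HollowSSet.{u} :=
  fun X => (∃! _x : X.toSSet _⦋0⦌, True) ∧ ∃! _f : X.toSSet _⦋1⦌, True

end HollowSSet

/-- The category of doubly degenerate weak Street `2`-categories and their functors, a full
subcategory of the category of simplicial sets with hollowness. -/
abbrev DoublyDegenerateStreetTwoCat :=
  (HollowSSet.isWeakStreetCategory.{u} 2 ⊓ HollowSSet.isDoublyDegenerate.{u}).FullSubcategory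

/-! A commutative monoid `M` has a nerve in the manner of the Eilenberg–Mac Lane space K(M, 2): an
n-simplex is a normalized 2-cocycle on Δ[n], and a triangle is hollow when its value is a unit. It
is a weak 2-category because the cocycle equation of a tetrahedron can be solved for a face that is
multiplied by a unit (`exists_face_of_isUnit`), and because on a 4-simplex four of the cocycle
equations imply the fifth once a unit is cancelled (`triangleCocycle_of_isUnit`). Saturation holds
since a 0-horn over a hollow triangle yields an inverse (`exists_inverse`). A map of nerves is
determined by its values on triangles, and tetrahedra with faces b, ab, a, 1 make it multiplicative,
so the nerve functor is fully faithful.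

For essential surjectivity, let X be doubly degenerate. Filling 3-horns with a degenerate face gives
two products of triangles. Filling 4-horns that contain a degenerate triangle shows that tetrahedra
are governed by these products (`isTetrahedron_iff`), that the products are opposite to each other,
and that they are associative and commutative. Hence X maps to the nerve of its monoid of triangles.
The difficulty is that a general simplex has no invertible triangle, so no admissible horn
determines it. `insertVertex` exhibits a cocycle as the face opposite to vertex 2 of a larger one
that is trivial on the triangles 012, 123, 234; every other face then has a trivial triangle on
consecutive vertices. Unique horn filling gives bijectivity by induction on the dimension
(`bijective_toCocycleNerve_succ`). Hollow triangles of X are invertible, and saturation of X gives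
the converse. -/

namespace Street

/-! ### The nerve of a commutative monoid -/

/-- Normalized `2`-cocycles on a standard simplex with values in a commutative monoid. -/
@[ext]
structure Cocycle (M : Type u) [CommMonoid M] (Δ : SimplexCategory) where
  val : (⦋2⦌ ⟶ Δ) → M
  val_eq_one (α : ⦋2⦌ ⟶ Δ) : ¬ Mono α → val α = 1
  val_mul_val (τ : ⦋3⦌ ⟶ Δ) :
    val (SimplexCategory.δ 2 ≫ τ) * val (SimplexCategory.δ 0 ≫ τ) =
      val (SimplexCategory.δ 1 ≫ τ) * val (SimplexCategory.δ 3 ≫ τ)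

section

variable {M N : Type u} [CommMonoid M] [CommMonoid N]

/-- The restriction of a cocycle along a map of simplices. -/
@[simps]
def Cocycle.comap {Δ Δ' : SimplexCategory} (c : Cocycle M Δ') (f : Δ ⟶ Δ') : Cocycle M Δ where
  val α := c.val (α ≫ f)
  val_eq_one α hα := c.val_eq_one _ fun _ => hα (mono_of_mono α f)
  val_mul_val τ := by simpa only [Category.assoc] using c.val_mul_val (τ ≫ f)

/-- The image of a cocycle under a homomorphism. -/
@[simps]
def Cocycle.push {Δ : SimplexCategory} (φ : M →* N) (c : Cocycle M Δ) : Cocycle N Δ where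
  val α := φ (c.val α)
  val_eq_one α hα := by rw [c.val_eq_one α hα, map_one]
  val_mul_val τ := by simp only [← map_mul, c.val_mul_val]

instance {Δ : SimplexCategory} : One (Cocycle M Δ) :=
  ⟨⟨fun _ => 1, fun _ _ => rfl, fun _ => rfl⟩⟩

@[simp]
lemma Cocycle.one_val {Δ : SimplexCategory} (α : ⦋2⦌ ⟶ Δ) : (1 : Cocycle M Δ).val α = 1 := rfl

variable (M) in
/-- The simplicial set whose `n`-simplices are the normalized `2`-cocycles on `Δ[n]`. -/
def cocycleNerve : SSet.{u} where
  obj Δ := Cocycle M Δ.unop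
  map f := ↾fun c => c.comap f.unop
  map_id _ := by
    ext c α
    exact congrArg (Cocycle.val c) (Category.comp_id α)
  map_comp _ _ := by ext; rfl

namespace cocycleNerve

/-- A cocycle as a simplex of the cocycle nerve. -/
def mk {Δ : SimplexCategory} (c : Cocycle M Δ) : (cocycleNerve M).obj (op Δ) := c

/-- The values of a simplex of the cocycle nerve. -/
def val {Δ : SimplexCategory} (c : (cocycleNerve M).obj (op Δ)) (α : ⦋2⦌ ⟶ Δ) : M :=
  Cocycle.val c α

variable {Δ Δ' : SimplexCategory}

@[simp]
lemma val_mk (c : Cocycle M Δ) (α : ⦋2⦌ ⟶ Δ) : val (mk c) α = c.val α := rfl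

lemma ext {c d : (cocycleNerve M).obj (op Δ)} (h : ∀ α, val c α = val d α) : c = d :=
  Cocycle.ext (funext h)

lemma val_eq_one (c : (cocycleNerve M).obj (op Δ)) (α : ⦋2⦌ ⟶ Δ) (hα : ¬ Mono α) :
    val c α = 1 :=
  Cocycle.val_eq_one c α hα

lemma val_mul_val (c : (cocycleNerve M).obj (op Δ)) (τ : ⦋3⦌ ⟶ Δ) :
    val c (SimplexCategory.δ 2 ≫ τ) * val c (SimplexCategory.δ 0 ≫ τ) =
      val c (SimplexCategory.δ 1 ≫ τ) * val c (SimplexCategory.δ 3 ≫ τ) :=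
  Cocycle.val_mul_val c τ

@[simp]
lemma val_map (f : Δ ⟶ Δ') (c : (cocycleNerve M).obj (op Δ')) (α : ⦋2⦌ ⟶ Δ) :
    val ((cocycleNerve M).map f.op c) α = val c (α ≫ f) := rfl

@[simp]
lemma val_δ {n : ℕ} (i : Fin (n + 2)) (c : (cocycleNerve M) _⦋n + 1⦌) (α : ⦋2⦌ ⟶ ⦋n⦌) :
    val ((cocycleNerve M).δ i c) α = val c (α ≫ SimplexCategory.δ i) := rfl

/-- The map of cocycle nerves induced by a homomorphism. -/
def map (φ : M →* N) : cocycleNerve M ⟶ cocycleNerve N where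
  app _ := ↾fun c => c.push φ
  naturality _ _ _ := rfl

@[simp]
lemma val_map_app (φ : M →* N) (c : (cocycleNerve M).obj (op Δ)) (α : ⦋2⦌ ⟶ Δ) :
    val ((map φ).app (op Δ) c) α = φ (val c α) := rfl

/-- A map into a cocycle nerve is determined by its values on `2`-simplices. -/
lemma val_app {X : SSet.{u}} (F : X ⟶ cocycleNerve M) (x : X.obj (op Δ)) (α : ⦋2⦌ ⟶ Δ) :
    val (F.app (op Δ) x) α = val (F.app (op ⦋2⦌) (X.map α.op x)) (𝟙 _) := by
  rw [NatTrans.naturality_apply F α.op x, val_map, Category.id_comp]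

lemma hom_ext {X : SSet.{u}} {F G : X ⟶ cocycleNerve M}
    (h : ∀ x : X _⦋2⦌, val (F.app (op ⦋2⦌) x) (𝟙 _) = val (G.app (op ⦋2⦌) x) (𝟙 _)) :
    F = G := by
  ext Δ x
  induction Δ using Opposite.rec with | op Δ =>
  refine ext fun α => ?_
  exact (val_app F x α).trans ((h _).trans (val_app G x α).symm)

end cocycleNerve

open cocycleNerve

lemma not_mono_of_lt {m n : ℕ} (h : m < n) (f : ⦋n⦌ ⟶ ⦋m⦌) : ¬ Mono f := fun _ =>
  absurd (SimplexCategory.le_of_mono f) (by lia)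

lemma not_mono_comp_of_lt {m n : ℕ} {Δ : SimplexCategory} (h : m < n) (f : ⦋n⦌ ⟶ ⦋m⦌)
    (g : ⦋m⦌ ⟶ Δ) : ¬ Mono (f ≫ g) := fun _ =>
  not_mono_of_lt h f (mono_of_mono f g)

variable (M) in
/-- The hollow `2`-simplices of the cocycle nerve are the invertible ones. -/
def cocycleNerveHollowness : Hollowness (cocycleNerve M) where
  hollow
    | 0 => ∅
    | 1 => Set.univ
    | 2 => {c | IsUnit (val c (𝟙 _))}
    | _ + 3 => Set.univ
  hollow_zero := rfl
  degenerate_subset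
    | 0 => by simp
    | 1 => Set.subset_univ _
    | 2 => by
      rintro _ ⟨m, hm, f, e, rfl⟩
      simp [val_eq_one e _ (not_mono_of_lt hm f)]
    | _ + 3 => Set.subset_univ _

lemma mem_hollow_two {c : (cocycleNerve M) _⦋2⦌} :
    c ∈ (cocycleNerveHollowness M).hollow 2 ↔ IsUnit (val c (𝟙 _)) := Iff.rfl

lemma mem_hollow_of_ne {n : ℕ} (h0 : n ≠ 0) (h2 : n ≠ 2) (c : (cocycleNerve M) _⦋n⦌) :
    c ∈ (cocycleNerveHollowness M).hollow n := by
  match n with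
  | 0 => contradiction
  | 1 => trivial
  | 2 => contradiction
  | _ + 3 => trivial

lemma cocycleNerve_subsingleton {n : ℕ} (hn : n < 2) : Subsingleton ((cocycleNerve M) _⦋n⦌) :=
  ⟨fun c d => ext fun α => by
    rw [val_eq_one c α (not_mono_of_lt hn α), val_eq_one d α (not_mono_of_lt hn α)]⟩

end

/-! ### Horns, fillers and admissibility in terms of faces -/

variable {X : SSet.{u}}

lemma map_op_comp {Δ Δ' Δ'' : SimplexCategory} (f : Δ ⟶ Δ') (g : Δ' ⟶ Δ'')
    (x : X.obj (op Δ'')) : X.map f.op (X.map g.op x) = X.map (f ≫ g).op x := by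
  rw [op_comp, Functor.map_comp_apply]

lemma map_δ {n : ℕ} {Δ : SimplexCategory} (f : Δ ⟶ ⦋n⦌) (i : Fin (n + 2)) (x : X _⦋n + 1⦌) :
    X.map f.op (X.δ i x) = X.map (f ≫ SimplexCategory.δ i).op x :=
  map_op_comp _ _ _

lemma mem_horn_iff_exists {m n : ℕ} {k : Fin (n + 2)} (α : ⦋m⦌ ⟶ ⦋n + 1⦌) :
    SSet.stdSimplex.objEquiv.symm α ∈ (Λ[n + 1, k] : (Δ[n + 1] : SSet.{u}).Subcomplex).obj
      (op ⦋m⦌) ↔ ∃ i ≠ k, ∃ β : ⦋m⦌ ⟶ ⦋n⦌, β ≫ SimplexCategory.δ i = α := by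
  rw [SSet.mem_horn_iff_notMem_range]
  constructor
  · rintro ⟨i, hi, h⟩
    exact ⟨i, hi, SimplexCategory.factor_δ α i,
      SimplexCategory.factor_δ_spec α i fun l hl => h ⟨l, hl⟩⟩
  · rintro ⟨i, hi, β, rfl⟩
    refine ⟨i, hi, ?_⟩
    rintro ⟨l, hl⟩
    exact Fin.succAbove_ne i (β l) hl

lemma horn_app_eq {m n : ℕ} {k : Fin (n + 2)} (f : (Λ[n + 1, k] : SSet.{u}) ⟶ X) (i : Fin (n + 2))
    (hi : i ≠ k) (β : ⦋m⦌ ⟶ ⦋n⦌)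
    (h : SSet.stdSimplex.objEquiv.symm (β ≫ SimplexCategory.δ i) ∈
      (Λ[n + 1, k] : (Δ[n + 1] : SSet.{u}).Subcomplex).obj (op ⦋m⦌)) :
    f.app (op ⦋m⦌) ⟨_, h⟩ = X.map β.op (f.app (op ⦋n⦌) (SSet.horn.face k i hi)) := by
  rw [← NatTrans.naturality_apply]
  rfl

lemma isFiller_iff {n : ℕ} {k : Fin (n + 2)} (f : (Λ[n + 1, k] : SSet.{u}) ⟶ X)
    (x : X _⦋n + 1⦌) : Hollowness.IsFiller f x ↔
      ∀ i (hi : i ≠ k), X.δ i x = f.app (op ⦋n⦌) (SSet.horn.face k i hi) := by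
  constructor
  · rintro rfl i hi
    rfl
  · intro h
    exact SSet.horn.hom_ext _ _ fun i hi => h i hi

variable (S : Hollowness X)

lemma isAdmissibleHorn_iff {n : ℕ} {k : Fin (n + 2)} (f : (Λ[n + 1, k] : SSet.{u}) ⟶ X) :
    S.IsAdmissibleHorn f ↔ ∀ i (hi : i ≠ k) (r : ℕ) (β : ⦋r⦌ ⟶ ⦋n⦌),
      ContainsNeighbours k (β ≫ SimplexCategory.δ i) →
        X.map β.op (f.app (op ⦋n⦌) (SSet.horn.face k i hi)) ∈ S.hollow r := by
  constructor
  · intro h i hi r β hβ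
    have hm := (mem_horn_iff_exists.{u} (k := k) (β ≫ SimplexCategory.δ i)).2 ⟨i, hi, β, rfl⟩
    rw [← horn_app_eq f i hi β hm]
    exact h r _ hm hβ
  · intro h r α hα hk
    obtain ⟨i, hi, β, rfl⟩ := (mem_horn_iff_exists α).1 hα
    rw [horn_app_eq f i hi β hα]
    exact h i hi r β hk

/-- A family of simplices that agree on common faces extends to the horn. -/
lemma exists_horn {n : ℕ} (k : Fin (n + 3)) (x : Fin (n + 3) → X _⦋n + 1⦌)
    (hx : ∀ i j, i ≠ k → j ≠ k → ∀ α β : ⦋n⦌ ⟶ ⦋n + 1⦌,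
      α ≫ SimplexCategory.δ i = β ≫ SimplexCategory.δ j → X.map α.op (x i) = X.map β.op (x j)) :
    ∃ f : (Λ[n + 2, k] : SSet.{u}) ⟶ X,
      ∀ i (hi : i ≠ k), f.app (op ⦋n + 1⦌) (SSet.horn.face k i hi) = x i := by
  have hc : SSet.horn.IsCompatible (i := k) fun i _ => SSet.yonedaEquiv.symm (x i) := by
    rw [SSet.horn.isCompatible_iff]
    intro i j hi hj hij
    rw [SSet.stdSimplex.δ_comp_yonedaEquiv_symm, SSet.stdSimplex.δ_comp_yonedaEquiv_symm]
    refine congrArg _ (hx i j hi hj _ _ ?_)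
    obtain ⟨i, rfl⟩ := i.eq_castSucc_of_ne_last (Fin.ne_last_of_lt hij)
    obtain ⟨j, rfl⟩ := j.eq_succ_of_ne_zero (Fin.ne_zero_of_lt hij)
    rw [Fin.pred_succ, Fin.castPred_castSucc]
    exact (SimplexCategory.δ_comp_δ (by grind)).symm
  obtain ⟨f, hf⟩ := hc.exists_desc
  refine ⟨f, fun i hi => ?_⟩
  have := congrArg SSet.yonedaEquiv (hf i hi)
  rw [Equiv.apply_symm_apply, SSet.yonedaEquiv_comp, SSet.horn.yonedaEquiv_ι] at this
  exact this

variable {S}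

lemma Hollowness.IsComplicial.exists_of_faces (hS : S.IsComplicial) {n : ℕ} (k : Fin (n + 3))
    (x : Fin (n + 3) → X _⦋n + 1⦌)
    (hx : ∀ i j, i ≠ k → j ≠ k → ∀ α β : ⦋n⦌ ⟶ ⦋n + 1⦌,
      α ≫ SimplexCategory.δ i = β ≫ SimplexCategory.δ j → X.map α.op (x i) = X.map β.op (x j))
    (hk : ∀ i, i ≠ k → ∀ (r : ℕ) (β : ⦋r⦌ ⟶ ⦋n + 1⦌),
      ContainsNeighbours k (β ≫ SimplexCategory.δ i) → X.map β.op (x i) ∈ S.hollow r) :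
    ∃ z : X _⦋n + 2⦌, ∀ i, i ≠ k → X.δ i z = x i := by
  obtain ⟨f, hf⟩ := exists_horn k x hx
  obtain ⟨z, -, hz⟩ := hS.exists_filler f ((isAdmissibleHorn_iff S f).2 fun i hi r β h => by
    rw [hf i hi]; exact hk i hi r β h)
  exact ⟨z, fun i hi => ((isFiller_iff f z).1 hz i hi).trans (hf i hi)⟩

lemma Hollowness.IsWeakCategory.eq_of_faces {d : ℕ} (hS : S.IsWeakCategory d) {n : ℕ}
    (hn : d < n + 1) (k : Fin (n + 2)) {z z' : X _⦋n + 1⦌}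
    (h : ∀ i, i ≠ k → X.δ i z = X.δ i z')
    (hk : ∀ (r : ℕ) (α : ⦋r⦌ ⟶ ⦋n + 1⦌), ¬ Function.Surjective α →
      ContainsNeighbours k α → X.map α.op z ∈ S.hollow r) :
    z = z' := by
  let f : (Λ[n + 1, k] : SSet.{u}) ⟶ X := SSet.Subcomplex.ι _ ≫ SSet.yonedaEquiv.symm z
  refine hS.filler_unique f hn (fun r α hα hα' => hk r α ?_ hα') z z' rfl ?_
  · obtain ⟨i, hi, β, rfl⟩ := (mem_horn_iff_exists α).1 hα
    intro h
    obtain ⟨l, hl⟩ := h i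
    exact Fin.succAbove_ne i (β l) hl
  · rw [isFiller_iff]
    intro i hi
    exact (h i hi).symm

lemma ContainsNeighbours.of_comp {m r s : ℕ} {k : Fin (m + 1)} {β : ⦋r⦌ ⟶ ⦋s⦌} {α : ⦋s⦌ ⟶ ⦋m⦌}
    (h : ContainsNeighbours k (β ≫ α)) : ContainsNeighbours k α := fun j h1 h2 => by
  obtain ⟨l, hl⟩ := h j h1 h2
  exact ⟨β l, hl⟩

lemma ContainsNeighbours.ne_zero {m r : ℕ} {k : Fin (m + 2)} {α : ⦋r⦌ ⟶ ⦋m + 1⦌}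
    (h : ContainsNeighbours k α) : r ≠ 0 := by
  rintro rfl
  obtain ⟨j, hj, h1, h2⟩ : ∃ j : Fin (m + 2), j ≠ k ∧ (j : ℕ) ≤ k + 1 ∧ (k : ℕ) ≤ j + 1 := by
    by_cases hk : (k : ℕ) = 0
    · exact ⟨1, fun h => by simp [← h] at hk, by simp, by lia⟩
    · exact ⟨⟨k - 1, by lia⟩, fun h => by simp [Fin.ext_iff] at h; lia, by simp; lia,
        by simp; lia⟩
  obtain ⟨a, ha⟩ := h j h1 h2
  obtain ⟨b, hb⟩ := h k (by lia) (by lia)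
  exact hj (by rw [← ha, ← hb, show a = b from Subsingleton.elim (α := Fin 1) a b])

lemma containsNeighbours_mkOfLeComp {n : ℕ} (k i j l : Fin (n + 1)) (h₁ : i ≤ j) (h₂ : j ≤ l)
    (h : ∀ a : Fin (n + 1), (a : ℕ) ≤ k + 1 → (k : ℕ) ≤ a + 1 → a = i ∨ a = j ∨ a = l) :
    ContainsNeighbours k (SimplexCategory.mkOfLeComp i j l h₁ h₂) := fun a ha ha' => by
  obtain rfl | rfl | rfl := h a ha ha'
  exacts [⟨(0 : Fin 3), rfl⟩, ⟨(1 : Fin 3), rfl⟩, ⟨(2 : Fin 3), rfl⟩]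

/-- A simplex of the standard simplex belongs to the horn. -/
abbrev InHorn {m n : ℕ} (k : Fin (n + 2)) (α : ⦋m⦌ ⟶ ⦋n + 1⦌) : Prop :=
  SSet.stdSimplex.objEquiv.symm α ∈
    (Λ[n + 1, k] : (Δ[n + 1] : SSet.{u}).Subcomplex).obj (op ⦋m⦌)

lemma InHorn.comp {m m' n : ℕ} {k : Fin (n + 2)} {α : ⦋m⦌ ⟶ ⦋n + 1⦌} (h : InHorn.{u} k α)
    (β : ⦋m'⦌ ⟶ ⦋m⦌) : InHorn.{u} k (β ≫ α) :=
  Subfunctor.map (Λ[n + 1, k] : (Δ[n + 1] : SSet.{u}).Subcomplex) β.op h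

variable {X : SSet.{u}} {S : Hollowness X}

lemma map_mem_degenerate {m n : ℕ} (β : ⦋m⦌ ⟶ ⦋n⦌) (hβ : ¬ Mono β) (x : X _⦋n⦌) :
    X.map β.op x ∈ X.degenerate m := by
  match m with
  | 0 =>
    refine absurd ?_ hβ
    rw [SimplexCategory.mono_iff_injective]
    exact fun a b _ => Subsingleton.elim (α := Fin 1) a b
  | m + 1 =>
    obtain ⟨i, θ, rfl⟩ := SimplexCategory.eq_σ_comp_of_not_injective β
      (by rwa [← SimplexCategory.mono_iff_injective])
    rw [← map_op_comp]
    exact SSet.σ_mem_degenerate _ _ _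

lemma Hollowness.map_mem {n : ℕ} {x : X _⦋n⦌} (hx : x ∈ S.hollow n) (β : ⦋n⦌ ⟶ ⦋n⦌) :
    X.map β.op x ∈ S.hollow n := by
  by_cases hβ : Mono β
  · obtain rfl := SimplexCategory.eq_id_of_mono β
    simpa using hx
  · exact S.degenerate_subset n (map_mem_degenerate β hβ x)

/-- Horns on a tetrahedron can be filled if their faces that contain the neighbours of the vertex
are hollow. -/
lemma Hollowness.IsComplicial.exists_tetrahedron (hS : S.IsComplicial)
    (h1 : Subsingleton (X _⦋1⦌)) (hu : ∀ r, r ≠ 0 → r ≠ 2 → ∀ x, x ∈ S.hollow r)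
    (k : Fin 4) (x : Fin 4 → X _⦋2⦌)
    (hk : ∀ i, i ≠ k → ContainsNeighbours k (SimplexCategory.δ i : ⦋2⦌ ⟶ ⦋3⦌) →
      x i ∈ S.hollow 2) :
    ∃ z : X _⦋3⦌, ∀ i, i ≠ k → X.δ i z = x i := by
  refine hS.exists_of_faces k x (fun _ _ _ _ _ _ _ => Subsingleton.elim _ _) fun i hi r β h => ?_
  by_cases hr : r = 2
  · subst hr
    exact S.map_mem (hk i hi h.of_comp) β
  · exact hu r h.ne_zero hr _

/-! ### Extending a cocycle from a horn -/

section

variable {M : Type u} [CommMonoid M]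

open cocycleNerve

instance : Subsingleton ((cocycleNerve M) _⦋0⦌) := cocycleNerve_subsingleton (by lia)

instance : Subsingleton ((cocycleNerve M) _⦋1⦌) := cocycleNerve_subsingleton (by lia)

lemma isFiller_cocycleNerve_iff {n : ℕ} {k : Fin (n + 2)}
    (f : (Λ[n + 1, k] : SSet.{u}) ⟶ cocycleNerve M) (z : (cocycleNerve M) _⦋n + 1⦌) :
    Hollowness.IsFiller f z ↔ ∀ (α : ⦋2⦌ ⟶ ⦋n + 1⦌)
      (h : InHorn.{u} k α),
      val z α = val (f.app (op ⦋2⦌) ⟨_, h⟩) (𝟙 _) := by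
  constructor
  · rintro rfl α h
    exact congrArg (val z) (Category.id_comp α).symm
  · intro h
    refine hom_ext fun x => ?_
    refine Eq.trans ?_ (h (SSet.stdSimplex.objEquiv x.1) x.2)
    exact congrArg (val z) (Category.id_comp _)

/-- Collapsing two adjacent vertices identifies the two opposite faces, which lie on different sides
of the equation, and makes the remaining two faces degenerate. -/
lemma mul_val_eq_of_not_mono {Δ : SimplexCategory} (g : (⦋2⦌ ⟶ Δ) → M)
    (hg : ∀ α, ¬ Mono α → g α = 1) (τ : ⦋3⦌ ⟶ Δ) (hτ : ¬ Mono τ) :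
    g (SimplexCategory.δ 2 ≫ τ) * g (SimplexCategory.δ 0 ≫ τ) =
      g (SimplexCategory.δ 1 ≫ τ) * g (SimplexCategory.δ 3 ≫ τ) := by
  obtain ⟨i, θ, rfl⟩ := SimplexCategory.eq_σ_comp_of_not_injective τ
    (by rwa [← SimplexCategory.mono_iff_injective])
  have key : ∀ (α : ⦋2⦌ ⟶ ⦋3⦌) (j : Fin 2) (ε : ⦋1⦌ ⟶ ⦋2⦌), α ≫ SimplexCategory.σ i =
      SimplexCategory.σ j ≫ ε → g (α ≫ SimplexCategory.σ i ≫ θ) = 1 := fun α j ε h => by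
    rw [← Category.assoc, h, Category.assoc]
    exact hg _ (not_mono_comp_of_lt (by lia) _ _)
  have same : ∀ α β : ⦋2⦌ ⟶ ⦋3⦌, α ≫ SimplexCategory.σ i = β ≫ SimplexCategory.σ i →
      g (α ≫ SimplexCategory.σ i ≫ θ) = g (β ≫ SimplexCategory.σ i ≫ θ) := fun α β h => by
    rw [← Category.assoc, h, Category.assoc]
  obtain rfl | rfl | rfl : i = 0 ∨ i = 1 ∨ i = 2 := by fin_cases i <;> simp
  · rw [key (SimplexCategory.δ 2) 0 (SimplexCategory.δ 1) (by decide),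
      key (SimplexCategory.δ 3) 0 (SimplexCategory.δ 2) (by decide),
      same (SimplexCategory.δ 0) (SimplexCategory.δ 1) (by decide), one_mul, mul_one]
  · rw [key (SimplexCategory.δ 0) 0 (SimplexCategory.δ 0) (by decide),
      key (SimplexCategory.δ 3) 1 (SimplexCategory.δ 2) (by decide),
      same (SimplexCategory.δ 1) (SimplexCategory.δ 2) (by decide)]
  · rw [key (SimplexCategory.δ 0) 1 (SimplexCategory.δ 0) (by decide),
      key (SimplexCategory.δ 1) 1 (SimplexCategory.δ 1) (by decide),
      same (SimplexCategory.δ 2) (SimplexCategory.δ 3) (by decide), one_mul, mul_one]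

open Classical in
/-- The values of a cocycle on a horn, extended by a constant. -/
noncomputable def hornVal {n : ℕ} {k : Fin (n + 2)}
    (f : (Λ[n + 1, k] : SSet.{u}) ⟶ cocycleNerve M) (w : M) (α : ⦋2⦌ ⟶ ⦋n + 1⦌) : M :=
  if h : InHorn.{u} k α then
    val (f.app (op ⦋2⦌) ⟨_, h⟩) (𝟙 _) else w

lemma hornVal_comp {m n : ℕ} {k : Fin (n + 2)}
    (f : (Λ[n + 1, k] : SSet.{u}) ⟶ cocycleNerve M) (w : M) (α : ⦋m⦌ ⟶ ⦋n + 1⦌)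
    (h : InHorn.{u} k α) (β : ⦋2⦌ ⟶ ⦋m⦌) :
    hornVal f w (β ≫ α) = val (f.app (op ⦋m⦌) ⟨_, h⟩) β := by
  rw [hornVal, dif_pos (h.comp β)]
  exact (val_app f ⟨SSet.stdSimplex.objEquiv.symm α, h⟩ β).symm

/-- Only nondegenerate tetrahedra outside the horn impose a condition: those in the horn inherit
theirs from it. A single constant `w` suffices, since in dimension 3 just one triangle is missing,
in lower dimensions `w = 1` works, and in higher ones no triangle is missing. -/
lemma exists_filler_of_hornVal {n : ℕ} {k : Fin (n + 2)}
    (f : (Λ[n + 1, k] : SSet.{u}) ⟶ cocycleNerve M) (w : M)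
    (hw : ∀ α : ⦋2⦌ ⟶ ⦋n + 1⦌, ¬ Mono α → ¬ InHorn.{u} k α → w = 1)
    (hτ : ∀ τ : ⦋3⦌ ⟶ ⦋n + 1⦌, Mono τ → ¬ InHorn.{u} k τ →
      hornVal f w (SimplexCategory.δ 2 ≫ τ) * hornVal f w (SimplexCategory.δ 0 ≫ τ) =
        hornVal f w (SimplexCategory.δ 1 ≫ τ) * hornVal f w (SimplexCategory.δ 3 ≫ τ)) :
    ∃ z : (cocycleNerve M) _⦋n + 1⦌, Hollowness.IsFiller f z ∧ val z = hornVal f w := by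
  have hg : ∀ α, ¬ Mono α → hornVal f w α = 1 := fun α hα => by
    rw [hornVal]
    split_ifs with h
    · rw [← Category.id_comp α] at hα
      have := hornVal_comp f w α h (𝟙 _)
      obtain ⟨i, θ, rfl⟩ := SimplexCategory.eq_σ_comp_of_not_injective α
        (by rwa [← SimplexCategory.mono_iff_injective, ← Category.id_comp α])
      have hθ : InHorn.{u} k θ := by
        have h' := h.comp (SimplexCategory.δ i.castSucc)
        rwa [← Category.assoc, SimplexCategory.δ_comp_σ_self, Category.id_comp] at h'
      rw [← this, Category.id_comp, hornVal_comp f w θ hθ, val_eq_one _ _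
        (not_mono_of_lt (by lia) _)]
    · exact hw α hα h
  refine ⟨mk ⟨hornVal f w, hg, fun τ => ?_⟩, ?_, rfl⟩
  · by_cases hm : Mono τ
    · by_cases h : InHorn.{u} k τ
      · simp only [hornVal_comp f w τ h]
        simpa using val_mul_val (f.app (op ⦋3⦌) ⟨_, h⟩) (𝟙 _)
      · exact hτ τ hm h
    · exact mul_val_eq_of_not_mono _ hg τ hm
  · rw [isFiller_cocycleNerve_iff]
    exact fun α h => dif_pos h

end

lemma inHorn_of_lt {m n : ℕ} (h : m < n) (k : Fin (n + 2)) (α : ⦋m⦌ ⟶ ⦋n + 1⦌) :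
    InHorn.{u} k α := by
  rw [InHorn, SSet.horn_obj_eq_univ k m (by lia)]
  trivial

lemma inHorn_δ_iff {n : ℕ} {k i : Fin (n + 2)} :
    InHorn.{u} k (SimplexCategory.δ i : ⦋n⦌ ⟶ ⦋n + 1⦌) ↔ i ≠ k :=
  SSet.objEquiv_symm_δ_mem_horn_iff i k

lemma not_inHorn_id {n : ℕ} {k : Fin (n + 2)} : ¬ InHorn.{u} k (𝟙 ⦋n + 1⦌) :=
  SSet.objEquiv_symm_notMem_horn_of_isIso k (𝟙 ⦋n + 1⦌)

lemma eq_δ_of_not_inHorn {n : ℕ} {k : Fin (n + 2)} {α : ⦋n⦌ ⟶ ⦋n + 1⦌}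
    (h : ¬ InHorn.{u} k α) : α = SimplexCategory.δ k := by
  by_cases hα : Mono α
  · obtain ⟨i, rfl⟩ := SimplexCategory.eq_δ_of_mono α
    rw [inHorn_δ_iff, not_not] at h
    rw [h]
  · refine absurd ?_ h
    match n with
    | 0 =>
      refine absurd ?_ hα
      rw [SimplexCategory.mono_iff_injective]
      exact fun a b _ => Subsingleton.elim (α := Fin 1) a b
    | n + 1 =>
      obtain ⟨i, θ, rfl⟩ := SimplexCategory.eq_σ_comp_of_not_injective α
        (by rwa [← SimplexCategory.mono_iff_injective])
      exact (inHorn_of_lt (Nat.lt_succ_self n) k θ).comp _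

lemma containsNeighbours_iff {m r : ℕ} {k : Fin (m + 1)} {α : ⦋r⦌ ⟶ ⦋m⦌} :
    ContainsNeighbours k α ↔ ∀ j : Fin (m + 1), (j : ℕ) ≤ (k : ℕ) + 1 → (k : ℕ) ≤ (j : ℕ) + 1 →
      ∃ l : Fin (r + 1), α.toOrderHom l = j := Iff.rfl

/-! ### The cocycle equation in dimensions 3 and 4 -/

section

variable {M : Type u} [CommMonoid M]

lemma exists_mul_eq_of_isUnit {a : M} (ha : IsUnit a) (b : M) : ∃ w, a * w = b := by
  obtain ⟨u, rfl⟩ := ha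
  exact ⟨↑u⁻¹ * b, by rw [Units.mul_inv_cancel_left]⟩

/-- The cocycle condition of a tetrahedron with one missing face can be solved. -/
lemma exists_face_of_isUnit (k : Fin 4) (a : Fin 4 → M)
    (ha : ∀ i, i ≠ k → ContainsNeighbours k (SimplexCategory.δ i : ⦋2⦌ ⟶ ⦋3⦌) → IsUnit (a i)) :
    ∃ w, ∀ b : Fin 4 → M, b k = w → (∀ i, i ≠ k → b i = a i) → b 2 * b 0 = b 1 * b 3 := by
  obtain rfl | rfl | rfl | rfl : k = 0 ∨ k = 1 ∨ k = 2 ∨ k = 3 := by fin_cases k <;> simp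
  -- In each case the factor beside the unknown one is a face containing the neighbours of `k`: the
  -- pairs are 2, 0 and 1, 3.
  · obtain ⟨w, hw⟩ := exists_mul_eq_of_isUnit
      (ha 2 (by decide) (containsNeighbours_iff.2 (by decide))) (a 1 * a 3)
    exact ⟨w, fun b h0 h => by
      rw [h0, h 1 (by decide), h 2 (by decide), h 3 (by decide), hw]⟩
  · obtain ⟨w, hw⟩ := exists_mul_eq_of_isUnit
      (ha 3 (by decide) (containsNeighbours_iff.2 (by decide))) (a 2 * a 0)
    exact ⟨w, fun b h0 h => by
      rw [h0, h 0 (by decide), h 2 (by decide), h 3 (by decide), mul_comm w, hw]⟩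
  · obtain ⟨w, hw⟩ := exists_mul_eq_of_isUnit
      (ha 0 (by decide) (containsNeighbours_iff.2 (by decide))) (a 1 * a 3)
    exact ⟨w, fun b h0 h => by
      rw [h0, h 0 (by decide), h 1 (by decide), h 3 (by decide), mul_comm w, hw]⟩
  · obtain ⟨w, hw⟩ := exists_mul_eq_of_isUnit
      (ha 1 (by decide) (containsNeighbours_iff.2 (by decide))) (a 2 * a 0)
    exact ⟨w, fun b h0 h => by
      rw [h0, h 0 (by decide), h 1 (by decide), h 2 (by decide), hw]⟩

/-- A face of a tetrahedron with the cocycle condition is determined by the other faces. -/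
lemma face_eq_of_isUnit (k : Fin 4) (a b : Fin 4 → M)
    (hu : ∀ i, i ≠ k → ContainsNeighbours k (SimplexCategory.δ i : ⦋2⦌ ⟶ ⦋3⦌) → IsUnit (a i))
    (h : ∀ i, i ≠ k → b i = a i) (ha : a 2 * a 0 = a 1 * a 3) (hb : b 2 * b 0 = b 1 * b 3) :
    b k = a k := by
  obtain rfl | rfl | rfl | rfl : k = 0 ∨ k = 1 ∨ k = 2 ∨ k = 3 := by fin_cases k <;> simp
  · refine (hu 2 (by decide) (containsNeighbours_iff.2 (by decide))).mul_left_cancel ?_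
    rw [ha, ← h 2 (by decide), hb, h 1 (by decide), h 3 (by decide)]
  · refine (hu 3 (by decide) (containsNeighbours_iff.2 (by decide))).mul_right_cancel ?_
    rw [← ha, ← h 3 (by decide), ← hb, h 2 (by decide), h 0 (by decide)]
  · refine (hu 0 (by decide) (containsNeighbours_iff.2 (by decide))).mul_right_cancel ?_
    rw [ha, ← h 0 (by decide), hb, h 1 (by decide), h 3 (by decide)]
  · refine (hu 1 (by decide) (containsNeighbours_iff.2 (by decide))).mul_left_cancel ?_
    rw [← ha, ← h 1 (by decide), ← hb, h 2 (by decide), h 0 (by decide)]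

/-- The cocycle condition for a function of three vertices on a tetrahedron. -/
def TriangleCocycle {V : Type*} (t : V → V → V → M) (i j k l : V) : Prop :=
  t i j l * t j k l = t i k l * t i j k

/-- On a `4`-simplex, the cocycle condition for one tetrahedron follows from those for the
others. -/
lemma triangleCocycle_of_isUnit (k : Fin 5) (t : Fin 5 → Fin 5 → Fin 5 → M)
    (hu : ∀ i j l, i < j → j < l → (∀ a : Fin 5, (a : ℕ) ≤ k + 1 → (k : ℕ) ≤ a + 1 →
      a = i ∨ a = j ∨ a = l) → IsUnit (t i j l))
    (h : ∀ i, i ≠ k → TriangleCocycle t (i.succAbove 0) (i.succAbove 1) (i.succAbove 2)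
      (i.succAbove 3)) :
    TriangleCocycle t (k.succAbove 0) (k.succAbove 1) (k.succAbove 2) (k.succAbove 3) := by
  obtain rfl | rfl | rfl | rfl | rfl : k = 0 ∨ k = 1 ∨ k = 2 ∨ k = 3 ∨ k = 4 := by
    fin_cases k <;> simp
  · have h1 : t 0 2 4 * t 2 3 4 = t 0 3 4 * t 0 2 3 := h 1 (by decide)
    have h2 : t 0 1 4 * t 1 3 4 = t 0 3 4 * t 0 1 3 := h 2 (by decide)
    have h3 : t 0 1 4 * t 1 2 4 = t 0 2 4 * t 0 1 2 := h 3 (by decide)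
    have h4 : t 0 1 3 * t 1 2 3 = t 0 2 3 * t 0 1 2 := h 4 (by decide)
    -- The neighbours of 0 are 0 and 1, so the value on 014 is a unit; multiplied by it, the missing
    -- equation follows from the other four. The later cases cancel the values on 012, 123, 234 and
    -- 034.
    have := hu 0 1 4 (by decide) (by decide) (by decide)
    refine this.mul_left_cancel ?_
    change t 0 1 4 * (t 1 2 4 * t 2 3 4) = t 0 1 4 * (t 1 3 4 * t 1 2 3)
    grind
  · have h0 : t 1 2 4 * t 2 3 4 = t 1 3 4 * t 1 2 3 := h 0 (by decide)
    have h2 : t 0 1 4 * t 1 3 4 = t 0 3 4 * t 0 1 3 := h 2 (by decide)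
    have h3 : t 0 1 4 * t 1 2 4 = t 0 2 4 * t 0 1 2 := h 3 (by decide)
    have h4 : t 0 1 3 * t 1 2 3 = t 0 2 3 * t 0 1 2 := h 4 (by decide)
    have := hu 0 1 2 (by decide) (by decide) (by decide)
    refine this.mul_left_cancel ?_
    change t 0 1 2 * (t 0 2 4 * t 2 3 4) = t 0 1 2 * (t 0 3 4 * t 0 2 3)
    grind
  · have h0 : t 1 2 4 * t 2 3 4 = t 1 3 4 * t 1 2 3 := h 0 (by decide)
    have h1 : t 0 2 4 * t 2 3 4 = t 0 3 4 * t 0 2 3 := h 1 (by decide)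
    have h3 : t 0 1 4 * t 1 2 4 = t 0 2 4 * t 0 1 2 := h 3 (by decide)
    have h4 : t 0 1 3 * t 1 2 3 = t 0 2 3 * t 0 1 2 := h 4 (by decide)
    have := hu 1 2 3 (by decide) (by decide) (by decide)
    refine this.mul_left_cancel ?_
    change t 1 2 3 * (t 0 1 4 * t 1 3 4) = t 1 2 3 * (t 0 3 4 * t 0 1 3)
    grind
  · have h0 : t 1 2 4 * t 2 3 4 = t 1 3 4 * t 1 2 3 := h 0 (by decide)
    have h1 : t 0 2 4 * t 2 3 4 = t 0 3 4 * t 0 2 3 := h 1 (by decide)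
    have h2 : t 0 1 4 * t 1 3 4 = t 0 3 4 * t 0 1 3 := h 2 (by decide)
    have h4 : t 0 1 3 * t 1 2 3 = t 0 2 3 * t 0 1 2 := h 4 (by decide)
    have := hu 2 3 4 (by decide) (by decide) (by decide)
    refine this.mul_left_cancel ?_
    change t 2 3 4 * (t 0 1 4 * t 1 2 4) = t 2 3 4 * (t 0 2 4 * t 0 1 2)
    grind
  · have h0 : t 1 2 4 * t 2 3 4 = t 1 3 4 * t 1 2 3 := h 0 (by decide)
    have h1 : t 0 2 4 * t 2 3 4 = t 0 3 4 * t 0 2 3 := h 1 (by decide)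
    have h2 : t 0 1 4 * t 1 3 4 = t 0 3 4 * t 0 1 3 := h 2 (by decide)
    have h3 : t 0 1 4 * t 1 2 4 = t 0 2 4 * t 0 1 2 := h 3 (by decide)
    have := hu 0 3 4 (by decide) (by decide) (by decide)
    refine this.mul_left_cancel ?_
    change t 0 3 4 * (t 0 1 3 * t 1 2 3) = t 0 3 4 * (t 0 2 3 * t 0 1 2)
    grind

end

/-! ### The nerve has fillers, and they are unique above dimension 2 -/

section

variable {M : Type u} [CommMonoid M]

open cocycleNerve

lemma isUnit_hornVal {n : ℕ} {k : Fin (n + 2)} {f : (Λ[n + 1, k] : SSet.{u}) ⟶ cocycleNerve M}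
    (hf : (cocycleNerveHollowness M).IsAdmissibleHorn f) (w : M) {α : ⦋2⦌ ⟶ ⦋n + 1⦌}
    (hα : InHorn.{u} k α) (h : ContainsNeighbours k α) : IsUnit (hornVal f w α) := by
  rw [hornVal, dif_pos hα]
  exact hf 2 α hα h

/-- A family indexed by the triples of vertices, from a family indexed by triangles. -/
def triangleFun {n : ℕ} (g : (⦋2⦌ ⟶ ⦋n⦌) → M) (i j k : Fin (n + 1)) : M :=
  if h : i ≤ j ∧ j ≤ k then g (SimplexCategory.mkOfLeComp i j k h.1 h.2) else 1

lemma triangleFun_eq {n : ℕ} (g : (⦋2⦌ ⟶ ⦋n⦌) → M) {i j k : Fin (n + 1)} (hij : i ≤ j)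
    (hjk : j ≤ k) : triangleFun g i j k = g (SimplexCategory.mkOfLeComp i j k hij hjk) :=
  dif_pos ⟨hij, hjk⟩

lemma eq_triangleFun {n : ℕ} (g : (⦋2⦌ ⟶ ⦋n⦌) → M) (α : ⦋2⦌ ⟶ ⦋n⦌) :
    g α = triangleFun g (α.toOrderHom 0) (α.toOrderHom 1) (α.toOrderHom 2) := by
  rw [triangleFun_eq g (α.toOrderHom.monotone (by decide)) (α.toOrderHom.monotone (by decide))]
  congr 1
  ext i
  fin_cases i <;> rfl

lemma triangleCocycle_triangleFun_iff {n : ℕ} (g : (⦋2⦌ ⟶ ⦋n⦌) → M) (τ : ⦋3⦌ ⟶ ⦋n⦌) :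
    TriangleCocycle (triangleFun g) (τ.toOrderHom 0) (τ.toOrderHom 1) (τ.toOrderHom 2)
      (τ.toOrderHom 3) ↔
      g (SimplexCategory.δ 2 ≫ τ) * g (SimplexCategory.δ 0 ≫ τ) =
        g (SimplexCategory.δ 1 ≫ τ) * g (SimplexCategory.δ 3 ≫ τ) := by
  rw [eq_triangleFun g (SimplexCategory.δ 2 ≫ τ), eq_triangleFun g (SimplexCategory.δ 0 ≫ τ),
    eq_triangleFun g (SimplexCategory.δ 1 ≫ τ), eq_triangleFun g (SimplexCategory.δ 3 ≫ τ)]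
  rfl

/-- Up to dimension 2 the missing value may be 1. In dimension 3 it solves the cocycle equation. In
dimension 4 no triangle is missing but one cocycle equation has to be derived, and beyond that every
tetrahedron lies in the horn. -/
lemma exists_filler_cocycleNerve {n : ℕ} {k : Fin (n + 2)}
    (f : (Λ[n + 1, k] : SSet.{u}) ⟶ cocycleNerve M)
    (hf : (cocycleNerveHollowness M).IsAdmissibleHorn f) :
    ∃ x ∈ (cocycleNerveHollowness M).hollow (n + 1), Hollowness.IsFiller f x := by
  match n with
  | 0 =>
    obtain ⟨z, hz, -⟩ := exists_filler_of_hornVal f 1 (fun _ _ _ => rfl)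
      fun τ hτ => absurd hτ (not_mono_of_lt (by lia) τ)
    exact ⟨z, mem_hollow_of_ne (by lia) (by lia) z, hz⟩
  | 1 =>
    obtain ⟨z, hz, hz'⟩ := exists_filler_of_hornVal f 1 (fun _ _ _ => rfl)
      fun τ hτ => absurd hτ (not_mono_of_lt (by lia) τ)
    refine ⟨z, mem_hollow_two.2 ?_, hz⟩
    rw [hz', hornVal, dif_neg not_inHorn_id]
    exact isUnit_one
  | 2 =>
    obtain ⟨w, hw⟩ := exists_face_of_isUnit k (fun i => hornVal f 1 (SimplexCategory.δ i))
      fun i hi hi' => isUnit_hornVal hf _ (inHorn_δ_iff.2 hi) hi'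
    obtain ⟨z, hz, -⟩ := exists_filler_of_hornVal f w
      (fun α hα hα' => absurd (eq_δ_of_not_inHorn hα' ▸ inferInstance) hα) fun τ hτ _ => by
        obtain rfl := SimplexCategory.eq_id_of_mono τ
        simp only [Category.comp_id]
        refine hw (fun i => hornVal f w (SimplexCategory.δ i)) ?_ fun i hi => ?_
        · exact dif_neg (mt inHorn_δ_iff.1 (not_not.2 rfl))
        · have hi' := inHorn_δ_iff.2 hi
          rw [hornVal, dif_pos hi', hornVal, dif_pos hi']
    exact ⟨z, mem_hollow_of_ne (by lia) (by lia) z, hz⟩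
  | 3 =>
    obtain ⟨z, hz, -⟩ := exists_filler_of_hornVal f 1 (fun _ _ _ => rfl) fun τ hτ hτ' => by
      obtain rfl := eq_δ_of_not_inHorn hτ'
      rw [← triangleCocycle_triangleFun_iff]
      refine triangleCocycle_of_isUnit k _ (fun i j l hij hjl h => ?_) fun i hi => ?_
      · rw [triangleFun_eq _ hij.le hjl.le]
        exact isUnit_hornVal hf _ (inHorn_of_lt (by lia) k _)
          (containsNeighbours_mkOfLeComp k i j l _ _ h)
      · refine (triangleCocycle_triangleFun_iff (hornVal f 1) (SimplexCategory.δ i)).2 ?_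
        have hi' := inHorn_δ_iff.{u}.2 hi
        simp only [hornVal_comp f 1 _ hi']
        simpa using val_mul_val (f.app (op ⦋3⦌) ⟨_, hi'⟩) (𝟙 _)
    exact ⟨z, mem_hollow_of_ne (by lia) (by lia) z, hz⟩
  | n + 4 =>
    obtain ⟨z, hz, -⟩ := exists_filler_of_hornVal f 1 (fun _ _ _ => rfl)
      fun τ _ hτ => absurd (inHorn_of_lt (by lia) k τ) hτ
    exact ⟨z, mem_hollow_of_ne (by lia) (by lia) z, hz⟩

/-- The cocycle condition of a `3`-simplex in terms of its faces. -/
lemma val_δ_mul_val_δ (x : (cocycleNerve M) _⦋3⦌) :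
    val x (SimplexCategory.δ 2) * val x (SimplexCategory.δ 0) =
      val x (SimplexCategory.δ 1) * val x (SimplexCategory.δ 3) := by
  simpa using val_mul_val x (𝟙 _)

/-- In a commutative monoid the factors of a unit are units, so the cocycle equation passes
invertibility from three faces to the fourth. -/
lemma face_hollow_cocycleNerve {n : ℕ} (k : Fin (n + 2)) (x : (cocycleNerve M) _⦋n + 1⦌)
    (h : ∀ i, i ≠ k → (cocycleNerve M).δ i x ∈ (cocycleNerveHollowness M).hollow n) :
    (cocycleNerve M).δ k x ∈ (cocycleNerveHollowness M).hollow n := by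
  obtain rfl | rfl | hn : n = 0 ∨ n = 2 ∨ n ≠ 0 ∧ n ≠ 2 := by lia
  · obtain ⟨i, hi⟩ := exists_ne k
    exact (h i hi).elim
  · simp only [mem_hollow_two, val_δ, Category.id_comp] at h ⊢
    have hx := val_δ_mul_val_δ x
    obtain rfl | rfl | rfl | rfl : k = 0 ∨ k = 1 ∨ k = 2 ∨ k = 3 := by fin_cases k <;> simp
    · exact isUnit_of_mul_isUnit_right (x := val x (SimplexCategory.δ 2))
        (hx ▸ (h 1 (by decide)).mul (h 3 (by decide)))
    · exact isUnit_of_mul_isUnit_left (y := val x (SimplexCategory.δ 3))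
        (hx ▸ (h 2 (by decide)).mul (h 0 (by decide)))
    · exact isUnit_of_mul_isUnit_left (y := val x (SimplexCategory.δ 0))
        (hx ▸ (h 1 (by decide)).mul (h 3 (by decide)))
    · exact isUnit_of_mul_isUnit_right (x := val x (SimplexCategory.δ 1))
        (hx ▸ (h 2 (by decide)).mul (h 0 (by decide)))
  · exact mem_hollow_of_ne hn.1 hn.2 _

variable (M) in
lemma isComplicial_cocycleNerve : (cocycleNerveHollowness M).IsComplicial where
  exists_filler f hf := exists_filler_cocycleNerve f hf
  face_hollow k x _ h := face_hollow_cocycleNerve k x h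

/-- Triangles determine a cocycle, and above dimension 3 they all lie in the horn. In dimension 3
the missing one is recovered by cancelling a unit. -/
lemma filler_unique_cocycleNerve {n : ℕ} {k : Fin (n + 2)}
    (f : (Λ[n + 1, k] : SSet.{u}) ⟶ cocycleNerve M) (hn : 2 < n + 1)
    (hf : (cocycleNerveHollowness M).IsAdmissibleHorn f) (x y : (cocycleNerve M) _⦋n + 1⦌)
    (hx : Hollowness.IsFiller f x) (hy : Hollowness.IsFiller f y) : x = y := by
  rw [isFiller_cocycleNerve_iff] at hx hy
  refine ext fun α => ?_
  by_cases hα : InHorn.{u} k α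
  · rw [hx α hα, hy α hα]
  · obtain rfl : n = 2 := by
      by_contra h
      exact hα (inHorn_of_lt (by lia) k α)
    obtain rfl := eq_δ_of_not_inHorn hα
    refine face_eq_of_isUnit k (fun i => val y (SimplexCategory.δ i))
      (fun i => val x (SimplexCategory.δ i)) (fun i hi h => ?_) (fun i hi => ?_)
      (val_δ_mul_val_δ y) (val_δ_mul_val_δ x)
    · simp only [hy _ (inHorn_δ_iff.2 hi)]
      exact hf 2 _ (inHorn_δ_iff.2 hi) h
    · simp only [hx _ (inHorn_δ_iff.2 hi), hy _ (inHorn_δ_iff.2 hi)]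

end

/-! ### Maps between nerves, and saturation -/

section

variable {M N : Type u} [CommMonoid M] [CommMonoid N]

namespace cocycleNerve

lemma not_mono_of_ne_id {n : ℕ} {α : ⦋n⦌ ⟶ ⦋n⦌} (h : α ≠ 𝟙 _) : ¬ Mono α := fun _ =>
  h (SimplexCategory.eq_id_of_mono α)

lemma ext_two {c d : (cocycleNerve M) _⦋2⦌} (h : val c (𝟙 _) = val d (𝟙 _)) : c = d :=
  ext fun α => by
    by_cases hα : α = 𝟙 _
    · rw [hα, h]
    · rw [val_eq_one c α (not_mono_of_ne_id hα), val_eq_one d α (not_mono_of_ne_id hα)]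

/-- The `2`-simplex of the cocycle nerve given by an element of the monoid. -/
def triangle (a : M) : (cocycleNerve M) _⦋2⦌ :=
  have h : ∀ α : ⦋2⦌ ⟶ ⦋2⦌, ¬ Mono α → (if α = 𝟙 ⦋2⦌ then a else 1) = 1 :=
    fun α hα => by
      rw [if_neg]
      rintro rfl
      exact hα inferInstance
  mk
    { val := fun α => if α = 𝟙 ⦋2⦌ then a else 1
      val_eq_one := h
      val_mul_val := fun τ => mul_val_eq_of_not_mono _ h τ (not_mono_of_lt (by lia) τ) }

@[simp]
lemma val_triangle_id (a : M) : val (triangle a) (𝟙 _) = a := by simp [triangle]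

lemma triangle_val (c : (cocycleNerve M) _⦋2⦌) : triangle (val c (𝟙 _)) = c :=
  ext_two (val_triangle_id _)

lemma triangle_one : triangle (1 : M) = (cocycleNerve M).map (SimplexCategory.σ 0).op (mk 1) :=
  ext_two (by simp)

/-- The `3`-simplex of the cocycle nerve that witnesses a product. -/
def tetrahedron (a b : M) : (cocycleNerve M) _⦋3⦌ :=
  have h : ∀ α : ⦋2⦌ ⟶ ⦋3⦌, ¬ Mono α → (if α = SimplexCategory.δ 0 then b else
      if α = SimplexCategory.δ 1 then a * b else if α = SimplexCategory.δ 2 then a else 1) = 1 :=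
    fun α hα => by
      rw [if_neg, if_neg, if_neg] <;> exact fun h => hα (h ▸ inferInstance)
  mk
    { val := fun α => if α = SimplexCategory.δ 0 then b else
        if α = SimplexCategory.δ 1 then a * b else if α = SimplexCategory.δ 2 then a else 1
      val_eq_one := h
      val_mul_val := fun τ => by
        by_cases hτ : Mono τ
        · obtain rfl := SimplexCategory.eq_id_of_mono τ
          simp [SimplexCategory.δ_injective.eq_iff]
        · exact mul_val_eq_of_not_mono _ h τ hτ }

lemma δ_tetrahedron_zero (a b : M) : (cocycleNerve M).δ 0 (tetrahedron a b) = triangle b :=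
  ext_two (by simp [tetrahedron])

lemma δ_tetrahedron_one (a b : M) : (cocycleNerve M).δ 1 (tetrahedron a b) = triangle (a * b) :=
  ext_two (by simp [tetrahedron, SimplexCategory.δ_injective.eq_iff])

lemma δ_tetrahedron_two (a b : M) : (cocycleNerve M).δ 2 (tetrahedron a b) = triangle a :=
  ext_two (by simp [tetrahedron, SimplexCategory.δ_injective.eq_iff])

lemma δ_tetrahedron_three (a b : M) : (cocycleNerve M).δ 3 (tetrahedron a b) = triangle 1 :=
  ext_two (by simp [tetrahedron, SimplexCategory.δ_injective.eq_iff])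

lemma val_app_triangle_one (F : cocycleNerve M ⟶ cocycleNerve N) :
    val (F.app (op ⦋2⦌) (triangle 1)) (𝟙 _) = 1 := by
  rw [triangle_one, NatTrans.naturality_apply F, val_map, Category.id_comp]
  exact val_eq_one _ _ (not_mono_of_lt (by lia) _)

/-- The homomorphism given by the action of a simplicial map on `2`-simplices. -/
def toMonoidHom (F : cocycleNerve M ⟶ cocycleNerve N) : M →* N where
  toFun a := val (F.app (op ⦋2⦌) (triangle a)) (𝟙 _)
  map_one' := val_app_triangle_one F
  map_mul' a b := by
    have h := val_δ_mul_val_δ (F.app (op ⦋3⦌) (tetrahedron a b))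
    have key (i : Fin 4) : val (F.app (op ⦋3⦌) (tetrahedron a b)) (SimplexCategory.δ i) =
        val (F.app (op ⦋2⦌) ((cocycleNerve M).δ i (tetrahedron a b))) (𝟙 _) := val_app F _ _
    rw [key, key, key, key, δ_tetrahedron_zero, δ_tetrahedron_one, δ_tetrahedron_two,
      δ_tetrahedron_three, val_app_triangle_one, mul_one] at h
    exact h.symm

@[simp]
lemma toMonoidHom_apply (F : cocycleNerve M ⟶ cocycleNerve N) (a : M) :
    toMonoidHom F a = val (F.app (op ⦋2⦌) (triangle a)) (𝟙 _) := rfl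

lemma map_toMonoidHom (F : cocycleNerve M ⟶ cocycleNerve N) : map (toMonoidHom F) = F :=
  hom_ext fun x => by rw [val_map_app, toMonoidHom_apply, triangle_val]

lemma map_app_mem_hollow (φ : M →* N) {n : ℕ} {x : (cocycleNerve M) _⦋n⦌}
    (hx : x ∈ (cocycleNerveHollowness M).hollow n) :
    (map φ).app (op ⦋n⦌) x ∈ (cocycleNerveHollowness N).hollow n := by
  obtain rfl | rfl | hn : n = 0 ∨ n = 2 ∨ n ≠ 0 ∧ n ≠ 2 := by lia
  · exact hx.elim
  · exact IsUnit.map φ hx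
  · exact mem_hollow_of_ne hn.1 hn.2 _

end cocycleNerve

open cocycleNerve

/-- Over a hollow triangle, there is a tetrahedron that exhibits an inverse of it. -/
lemma Hollowness.IsComplicial.exists_inverse {X : SSet.{u}} {S : Hollowness X}
    (hS : S.IsComplicial) (h1 : Subsingleton (X _⦋1⦌))
    (hu : ∀ r, r ≠ 0 → r ≠ 2 → ∀ x, x ∈ S.hollow r) {x e : X _⦋2⦌} (hx : x ∈ S.hollow 2)
    (he : e ∈ S.hollow 2) : ∃ z : X _⦋3⦌, X.δ 1 z = e ∧ X.δ 2 z = x ∧ X.δ 3 z = e := by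
  obtain ⟨z, hz⟩ := hS.exists_tetrahedron h1 hu 0 ![e, e, x, e] (by
    intro i _ _
    fin_cases i <;> assumption)
  exact ⟨z, hz 1 (by decide), hz 2 (by decide), hz 3 (by decide)⟩

/-- The tetrahedron over a hollow triangle `x` with its other prescribed faces trivial has a cocycle
equation of the form `x * y = 1`. -/
lemma subset_hollow_cocycleNerve {S : Hollowness (cocycleNerve M)} (hS : S.IsComplicial)
    (h : ∀ m, (cocycleNerveHollowness M).hollow m ⊆ S.hollow m) (m : ℕ) :
    S.hollow m ⊆ (cocycleNerveHollowness M).hollow m := by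
  obtain rfl | rfl | hm : m = 0 ∨ m = 2 ∨ m ≠ 0 ∧ m ≠ 2 := by lia
  · rw [S.hollow_zero]
    exact Set.empty_subset _
  · intro x hx
    obtain ⟨z, h1, h2, h3⟩ := hS.exists_inverse inferInstance
      (fun r h0 h2 x => h r (mem_hollow_of_ne h0 h2 x)) hx (e := triangle 1)
      (h 2 (mem_hollow_two.2 (by simp)))
    have hz : val ((cocycleNerve M).δ 2 z) (𝟙 _) * val ((cocycleNerve M).δ 0 z) (𝟙 _) =
        val ((cocycleNerve M).δ 1 z) (𝟙 _) * val ((cocycleNerve M).δ 3 z) (𝟙 _) := by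
      simpa using val_δ_mul_val_δ z
    rw [h1, h2, h3, val_triangle_id, mul_one] at hz
    exact IsUnit.of_mul_eq_one _ hz
  · exact fun x _ => mem_hollow_of_ne hm.1 hm.2 x

variable (M) in
lemma isWeakCategory_cocycleNerve : (cocycleNerveHollowness M).IsWeakCategory 2 where
  toIsComplicial := isComplicial_cocycleNerve M
  saturated _ := subset_hollow_cocycleNerve
  hollow_of_lt _ _ h := mem_hollow_of_ne (by lia) (by lia) _
  filler_unique f hn hf x y hx hy := filler_unique_cocycleNerve f hn hf x y hx hy

end

/-! ### The nerve functor is fully faithful -/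

/-- The cocycle nerve of a commutative monoid, as a doubly degenerate weak `2`-category. -/
def cocycleNerveTwoCat (M : Type u) [CommMonoid M] : DoublyDegenerateStreetTwoCat.{u} :=
  ⟨⟨cocycleNerve M, cocycleNerveHollowness M⟩, isWeakCategory_cocycleNerve M,
    ⟨cocycleNerve.mk 1, trivial, fun _ _ =>
      Subsingleton.elim (α := (cocycleNerve M) _⦋0⦌) _ _⟩,
    ⟨cocycleNerve.mk 1, trivial, fun _ _ =>
      Subsingleton.elim (α := (cocycleNerve M) _⦋1⦌) _ _⟩⟩

/-- The functor from commutative monoids to doubly degenerate weak `2`-categories. -/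
def cocycleNerveFunctor : CommMonCat.{u} ⥤ DoublyDegenerateStreetTwoCat.{u} where
  obj M := cocycleNerveTwoCat M
  map φ := ObjectProperty.homMk ⟨cocycleNerve.map φ.hom, fun _ _ h =>
    cocycleNerve.map_app_mem_hollow φ.hom h⟩
  map_id _ := rfl
  map_comp _ _ := rfl

instance : cocycleNerveFunctor.{u}.Faithful where
  map_injective {M N φ ψ} h := by
    ext a
    have h' : cocycleNerve.map φ.hom = cocycleNerve.map ψ.hom :=
      congrArg (fun f => HollowSSet.Hom.map (InducedCategory.Hom.hom f)) h
    have := congrArg (fun F : cocycleNerve M ⟶ cocycleNerve N =>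
      cocycleNerve.val (F.app (op ⦋2⦌) (cocycleNerve.triangle a)) (𝟙 _)) h'
    simpa only [cocycleNerve.val_map_app, cocycleNerve.val_triangle_id] using this

instance : cocycleNerveFunctor.{u}.Full where
  map_surjective {M N} f := ⟨CommMonCat.ofHom
    (cocycleNerve.toMonoidHom (HollowSSet.Hom.map f.hom :
      cocycleNerve M ⟶ cocycleNerve N)), by
    apply ObjectProperty.hom_ext
    exact HollowSSet.Hom.ext (cocycleNerve.map_toMonoidHom (M := M) (N := N) _)⟩

/-! ### Tetrahedra in a doubly degenerate weak 2-category -/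

section

variable {X : SSet.{u}} {S : Hollowness X}

lemma δ_σ_eq {i : Fin 4} {j : Fin 3} (h : SimplexCategory.δ i ≫ SimplexCategory.σ j = 𝟙 _)
    (a : X _⦋2⦌) : X.δ i (X.σ j a) = a := by
  refine (map_op_comp _ _ a).trans ?_
  rw [h]
  simp

/-- Four triangles form the boundary of a tetrahedron. -/
def IsTetrahedron (a₀ a₁ a₂ a₃ : X _⦋2⦌) : Prop :=
  ∃ z : X _⦋3⦌, X.δ 0 z = a₀ ∧ X.δ 1 z = a₁ ∧ X.δ 2 z = a₂ ∧ X.δ 3 z = a₃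

/-- The triangles `t i j k` form the boundary of a tetrahedron with the vertices `s`. -/
def IsTetrahedronOn {n : ℕ} (t : Fin n → Fin n → Fin n → X _⦋2⦌) (s : Fin 4 → Fin n) : Prop :=
  IsTetrahedron (t (s 1) (s 2) (s 3)) (t (s 0) (s 2) (s 3)) (t (s 0) (s 1) (s 3))
    (t (s 0) (s 1) (s 2))

lemma map_eq_of_δ {n : ℕ} {t : Fin n → Fin n → Fin n → X _⦋2⦌} {s : Fin 4 → Fin n} {z : X _⦋3⦌}
    (hz : X.δ 0 z = t (s 1) (s 2) (s 3) ∧ X.δ 1 z = t (s 0) (s 2) (s 3) ∧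
      X.δ 2 z = t (s 0) (s 1) (s 3) ∧ X.δ 3 z = t (s 0) (s 1) (s 2))
    (β : ⦋2⦌ ⟶ ⦋3⦌) [Mono β] :
    X.map β.op z = t (s (β.toOrderHom 0)) (s (β.toOrderHom 1)) (s (β.toOrderHom 2)) := by
  obtain ⟨i, rfl⟩ := SimplexCategory.eq_δ_of_mono β
  obtain ⟨h0, h1, h2, h3⟩ := hz
  fin_cases i
  exacts [h0, h1, h2, h3]

lemma mono_of_comp_eq {Δ Δ₁ Δ₂ Δ₃ : SimplexCategory} {α : Δ ⟶ Δ₁} {i : Δ₁ ⟶ Δ₃} {β : Δ ⟶ Δ₂}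
    {j : Δ₂ ⟶ Δ₃} [Mono β] [Mono j] (h : α ≫ i = β ≫ j) : Mono α :=
  have : Mono (α ≫ i) := h ▸ mono_comp β j
  mono_of_mono α i

lemma strictMono_of_mono {m n : ℕ} (α : ⦋m⦌ ⟶ ⦋n⦌) [hα : Mono α] : StrictMono α.toOrderHom :=
  α.toOrderHom.monotone.strictMono_of_injective (SimplexCategory.mono_iff_injective.1 hα)

variable [Unique (X _⦋0⦌)]

variable (X) in
/-- The degenerate triangle of a simplicial set with one vertex. -/
def unitTriangle : X _⦋2⦌ := X.map (SimplexCategory.const ⦋2⦌ ⦋0⦌ 0).op default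

variable (S) in
lemma unitTriangle_mem_hollow : unitTriangle X ∈ S.hollow 2 :=
  S.degenerate_subset 2 (map_mem_degenerate _ (not_mono_of_lt (by lia) _) _)

variable [Subsingleton (X _⦋1⦌)]

/-- A degenerate triangle factors through an edge, and the only edge is itself degenerate. -/
lemma map_eq_unitTriangle {n : ℕ} (x : X _⦋n⦌) (α : ⦋2⦌ ⟶ ⦋n⦌) (hα : ¬ Mono α) :
    X.map α.op x = unitTriangle X := by
  obtain ⟨i, θ, rfl⟩ := SimplexCategory.eq_σ_comp_of_not_injective α
    (by rwa [← SimplexCategory.mono_iff_injective])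
  rw [← map_op_comp, Subsingleton.elim (X.map θ.op x)
    (X.map (SimplexCategory.const ⦋1⦌ ⦋0⦌ 0).op default), map_op_comp, unitTriangle,
    SimplexCategory.eq_const_to_zero (SimplexCategory.σ i ≫ _)]

lemma δ_σ_eq_unitTriangle {i : Fin 4} {j : Fin 3}
    (h : SimplexCategory.δ i ≫ SimplexCategory.σ j ≠ 𝟙 _) (a : X _⦋2⦌) :
    X.δ i (X.σ j a) = unitTriangle X :=
  (map_op_comp _ _ a).trans (map_eq_unitTriangle a _ (cocycleNerve.not_mono_of_ne_id h))

lemma mem_hollow_of_subsingleton (hS : S.IsWeakCategory 2) (r : ℕ) (h0 : r ≠ 0) (h2 : r ≠ 2)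
    (x : X _⦋r⦌) : x ∈ S.hollow r := by
  obtain rfl | hr : r = 1 ∨ 2 < r := by lia
  · rw [Subsingleton.elim x (X.σ 0 default)]
    exact S.degenerate_subset 1 (SSet.σ_mem_degenerate _ _ _)
  · exact hS.hollow_of_lt r x hr

/-- The tetrahedra that bound a `4`-simplex with a hollow triangle at a vertex determine the
tetrahedron opposite to that vertex. -/
lemma isTetrahedronOn_of_ne (hS : S.IsWeakCategory 2) (k : Fin 5)
    (t : Fin 5 → Fin 5 → Fin 5 → X _⦋2⦌)
    (ht : ∀ i j l, i < j → j < l → (∀ a : Fin 5, (a : ℕ) ≤ k + 1 → (k : ℕ) ≤ a + 1 →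
      a = i ∨ a = j ∨ a = l) → t i j l = unitTriangle X)
    (h : ∀ i, i ≠ k → IsTetrahedronOn t i.succAbove) : IsTetrahedronOn t k.succAbove := by
  have hne : Nonempty (X _⦋3⦌) := ⟨X.map (SimplexCategory.const ⦋3⦌ ⦋0⦌ 0).op default⟩
  choose! x hx using h
  -- The tetrahedra are compatible: their nondegenerate faces are prescribed by `t` in terms of the
  -- vertices, and all other faces are the unit triangle.
  obtain ⟨z, hz⟩ := hS.exists_of_faces k x (fun i j hi hj α β h => by
      by_cases hα : Mono α
      · have hβ : Mono β := mono_of_comp_eq h.symm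
        rw [map_eq_of_δ (hx i hi) α, map_eq_of_δ (hx j hj) β]
        have key (l : Fin 3) : i.succAbove (α.toOrderHom l) = j.succAbove (β.toOrderHom l) :=
          congrArg (fun f => f.toOrderHom l) h
        rw [key, key, key]
      · have hβ : ¬ Mono β := fun _ => hα (mono_of_comp_eq h)
        rw [map_eq_unitTriangle _ α hα, map_eq_unitTriangle _ β hβ])
    (fun i hi r β h => by
      by_cases hr : r = 2
      · subst hr
        by_cases hβ : Mono β
        · rw [map_eq_of_δ (hx i hi) β, ht]
          · exact unitTriangle_mem_hollow S
          · exact Fin.strictMono_succAbove i (strictMono_of_mono β (by decide))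
          · exact Fin.strictMono_succAbove i (strictMono_of_mono β (by decide))
          · intro a ha ha'
            obtain ⟨l, hl⟩ := h a ha ha'
            change i.succAbove (β.toOrderHom l) = a at hl
            subst hl
            obtain rfl | rfl | rfl : l = (0 : Fin 3) ∨ l = (1 : Fin 3) ∨ l = (2 : Fin 3) := by
              change Fin 3 at l
              fin_cases l <;> simp
            all_goals simp
        · exact S.degenerate_subset 2 (map_mem_degenerate β hβ _)
      · exact mem_hollow_of_subsingleton hS r h.ne_zero hr _)
  have key (α : ⦋2⦌ ⟶ ⦋4⦌) (hα : Mono α) :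
      X.map α.op z = t (α.toOrderHom 0) (α.toOrderHom 1) (α.toOrderHom 2) := by
    obtain ⟨i, hi, β, rfl⟩ := (mem_horn_iff_exists.{u} α).1 (inHorn_of_lt (by lia) k α)
    have := mono_of_mono β (SimplexCategory.δ i)
    rw [← map_δ, hz i hi, map_eq_of_δ (hx i hi) β]
    rfl
  refine ⟨X.δ k z, ?_⟩
  refine ⟨(map_op_comp _ _ z).trans (key _ inferInstance),
    (map_op_comp _ _ z).trans (key _ inferInstance),
    (map_op_comp _ _ z).trans (key _ inferInstance),
    (map_op_comp _ _ z).trans (key _ inferInstance)⟩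

/-- Tetrahedra with a hollow triangle at a vertex are determined by the triangles at this
vertex. -/
lemma tetrahedron_ext (hS : S.IsWeakCategory 2) (k : Fin 4) {z z' : X _⦋3⦌}
    (hk : ∀ i, i ≠ k → ContainsNeighbours k (SimplexCategory.δ i : ⦋2⦌ ⟶ ⦋3⦌) →
      X.δ i z = unitTriangle X)
    (h : ∀ i, i ≠ k → X.δ i z = X.δ i z') : z = z' := by
  refine hS.eq_of_faces (by lia) k h fun r α hα h => ?_
  by_cases hr : r = 2
  · subst hr
    by_cases hm : Mono α
    · obtain ⟨i, rfl⟩ := SimplexCategory.eq_δ_of_mono α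
      have hi : i ≠ k := by
        rintro rfl
        obtain ⟨l, hl⟩ := h i (by lia) (by lia)
        exact Fin.succAbove_ne i l hl
      rw [← SimplicialObject.δ, hk i hi h]
      exact unitTriangle_mem_hollow S
    · exact S.degenerate_subset 2 (map_mem_degenerate α hm _)
  · exact mem_hollow_of_subsingleton hS r h.ne_zero hr _

/-- Among the given faces of a horn at vertex 1 only face 3 contains the vertices 0, 1, 2. Taking it
degenerate makes the horn admissible for arbitrary `a` and `b`. -/
lemma exists_mul (hS : S.IsWeakCategory 2) (a b : X _⦋2⦌) :
    ∃ c, IsTetrahedron b c a (unitTriangle X) := by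
  obtain ⟨z, hz⟩ := hS.exists_tetrahedron inferInstance (mem_hollow_of_subsingleton hS) 1
    ![b, b, a, unitTriangle X] (by
      intro i hi h
      obtain rfl : i = 3 := by
        revert i
        simp only [containsNeighbours_iff]
        decide
      exact unitTriangle_mem_hollow S)
  exact ⟨_, z, hz 0 (by decide), rfl, hz 2 (by decide), hz 3 (by decide)⟩

/-- The mirror image: the horn is at vertex 2, and the degenerate face is 123. -/
lemma exists_mul' (hS : S.IsWeakCategory 2) (a b : X _⦋2⦌) :
    ∃ c, IsTetrahedron (unitTriangle X) a c b := by
  obtain ⟨z, hz⟩ := hS.exists_tetrahedron inferInstance (mem_hollow_of_subsingleton hS) 2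
    ![unitTriangle X, a, a, b] (by
      intro i hi h
      obtain rfl : i = 0 := by
        revert i
        simp only [containsNeighbours_iff]
        decide
      exact unitTriangle_mem_hollow S)
  exact ⟨_, z, hz 0 (by decide), hz 1 (by decide), rfl, hz 3 (by decide)⟩

lemma isTetrahedron_unique (hS : S.IsWeakCategory 2) {a b c d : X _⦋2⦌}
    (h : IsTetrahedron b c a (unitTriangle X)) (h' : IsTetrahedron b d a (unitTriangle X)) :
    c = d := by
  obtain ⟨z, h0, rfl, h2, h3⟩ := h
  obtain ⟨z', h0', rfl, h2', h3'⟩ := h'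
  congr 1
  refine tetrahedron_ext hS 1 (fun i hi h => ?_) fun i hi => ?_
  · obtain rfl : i = 3 := by
      revert i
      simp only [containsNeighbours_iff]
      decide
    exact h3
  · fin_cases i
    exacts [h0.trans h0'.symm, absurd rfl hi, h2.trans h2'.symm, h3.trans h3'.symm]

lemma isTetrahedron_unique' (hS : S.IsWeakCategory 2) {a b c d : X _⦋2⦌}
    (h : IsTetrahedron (unitTriangle X) a c b) (h' : IsTetrahedron (unitTriangle X) a d b) :
    c = d := by
  obtain ⟨z, h0, h1, rfl, h3⟩ := h
  obtain ⟨z', h0', h1', rfl, h3'⟩ := h'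
  congr 1
  refine tetrahedron_ext hS 2 (fun i hi h => ?_) fun i hi => ?_
  · obtain rfl : i = 0 := by
      revert i
      simp only [containsNeighbours_iff]
      decide
    exact h0
  · fin_cases i
    exacts [h0.trans h0'.symm, h1.trans h1'.symm, absurd rfl hi, h3.trans h3'.symm]

lemma isTetrahedron_σ_zero (a : X _⦋2⦌) :
    IsTetrahedron a a (unitTriangle X) (unitTriangle X) :=
  ⟨X.σ 0 a, δ_σ_eq (by decide) a, δ_σ_eq (by decide) a, δ_σ_eq_unitTriangle (by decide) a,
    δ_σ_eq_unitTriangle (by decide) a⟩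

lemma isTetrahedron_σ_one (a : X _⦋2⦌) :
    IsTetrahedron (unitTriangle X) a a (unitTriangle X) :=
  ⟨X.σ 1 a, δ_σ_eq_unitTriangle (by decide) a, δ_σ_eq (by decide) a, δ_σ_eq (by decide) a,
    δ_σ_eq_unitTriangle (by decide) a⟩

lemma isTetrahedron_σ_two (a : X _⦋2⦌) :
    IsTetrahedron (unitTriangle X) (unitTriangle X) a a :=
  ⟨X.σ 2 a, δ_σ_eq_unitTriangle (by decide) a, δ_σ_eq_unitTriangle (by decide) a,
    δ_σ_eq (by decide) a, δ_σ_eq (by decide) a⟩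

/-- The function of the vertices of a `4`-simplex with the given values. -/
def pentagonFun {A : Type*} (a₀₁₂ a₀₁₃ a₀₁₄ a₀₂₃ a₀₂₄ a₀₃₄ a₁₂₃ a₁₂₄ a₁₃₄ a₂₃₄ : A) :
    Fin 5 → Fin 5 → Fin 5 → A := fun i j k => match i, j, k with
  | 0, 1, 2 => a₀₁₂
  | 0, 1, 3 => a₀₁₃
  | 0, 1, 4 => a₀₁₄
  | 0, 2, 3 => a₀₂₃
  | 0, 2, 4 => a₀₂₄
  | 0, 3, 4 => a₀₃₄
  | 1, 2, 3 => a₁₂₃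
  | 1, 2, 4 => a₁₂₄
  | 1, 3, 4 => a₁₃₄
  | _, _, _ => a₂₃₄

/-- The degenerate triangle 012 makes the 4-horn at vertex 1 admissible; the filler supplies the
tetrahedron 0234. -/
lemma isTetrahedron_of_pentagon_one (hS : S.IsWeakCategory 2)
    {a₀₁₃ a₀₁₄ a₀₂₃ a₀₂₄ a₀₃₄ a₁₂₃ a₁₂₄ a₁₃₄ a₂₃₄ : X _⦋2⦌}
    (h₀ : IsTetrahedron a₂₃₄ a₁₃₄ a₁₂₄ a₁₂₃) (h₂ : IsTetrahedron a₁₃₄ a₀₃₄ a₀₁₄ a₀₁₃)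
    (h₃ : IsTetrahedron a₁₂₄ a₀₂₄ a₀₁₄ (unitTriangle X))
    (h₄ : IsTetrahedron a₁₂₃ a₀₂₃ a₀₁₃ (unitTriangle X)) :
    IsTetrahedron a₂₃₄ a₀₃₄ a₀₂₄ a₀₂₃ := by
  refine isTetrahedronOn_of_ne hS 1 (pentagonFun (unitTriangle X) a₀₁₃ a₀₁₄ a₀₂₃ a₀₂₄ a₀₃₄ a₁₂₃
    a₁₂₄ a₁₃₄ a₂₃₄) (fun i j l hij hjl h => ?_) fun i hi => ?_
  · obtain ⟨rfl, rfl, rfl⟩ : i = 0 ∧ j = 1 ∧ l = 2 := by revert i j l; decide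
    rfl
  · fin_cases i
    exacts [h₀, absurd rfl hi, h₂, h₃, h₄]

/-- Here 123 is degenerate, the horn is at vertex 2, and the filler supplies the tetrahedron 0134.
-/
lemma isTetrahedron_of_pentagon_two (hS : S.IsWeakCategory 2)
    {a₀₁₂ a₀₁₃ a₀₁₄ a₀₂₃ a₀₂₄ a₀₃₄ a₁₂₄ a₁₃₄ a₂₃₄ : X _⦋2⦌}
    (h₀ : IsTetrahedron a₂₃₄ a₁₃₄ a₁₂₄ (unitTriangle X))
    (h₁ : IsTetrahedron a₂₃₄ a₀₃₄ a₀₂₄ a₀₂₃) (h₃ : IsTetrahedron a₁₂₄ a₀₂₄ a₀₁₄ a₀₁₂)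
    (h₄ : IsTetrahedron (unitTriangle X) a₀₂₃ a₀₁₃ a₀₁₂) :
    IsTetrahedron a₁₃₄ a₀₃₄ a₀₁₄ a₀₁₃ := by
  refine isTetrahedronOn_of_ne hS 2 (pentagonFun a₀₁₂ a₀₁₃ a₀₁₄ a₀₂₃ a₀₂₄ a₀₃₄ (unitTriangle X)
    a₁₂₄ a₁₃₄ a₂₃₄) (fun i j l hij hjl h => ?_) fun i hi => ?_
  · obtain ⟨rfl, rfl, rfl⟩ : i = 1 ∧ j = 2 ∧ l = 3 := by revert i j l; decide
    rfl
  · fin_cases i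
    exacts [h₀, h₁, absurd rfl hi, h₃, h₄]

end

/-! ### The commutative monoid of triangles -/

section

variable {X : SSet.{u}} [Unique (X _⦋0⦌)] [Subsingleton (X _⦋1⦌)] {S : Hollowness X}

/-- The composition of triangles along a tetrahedron with last face degenerate. -/
noncomputable def triangleMul (hS : S.IsWeakCategory 2) (a b : X _⦋2⦌) : X _⦋2⦌ :=
  (exists_mul hS a b).choose

lemma isTetrahedron_mul_iff (hS : S.IsWeakCategory 2) {a b c : X _⦋2⦌} :
    IsTetrahedron b c a (unitTriangle X) ↔ triangleMul hS a b = c :=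
  ⟨isTetrahedron_unique hS (exists_mul hS a b).choose_spec,
    fun h => h ▸ (exists_mul hS a b).choose_spec⟩

/-- The composition of triangles along a tetrahedron with first face degenerate. -/
noncomputable def triangleMul' (hS : S.IsWeakCategory 2) (a b : X _⦋2⦌) : X _⦋2⦌ :=
  (exists_mul' hS a b).choose

lemma isTetrahedron_mul'_iff (hS : S.IsWeakCategory 2) {a b c : X _⦋2⦌} :
    IsTetrahedron (unitTriangle X) a c b ↔ triangleMul' hS a b = c :=
  ⟨isTetrahedron_unique' hS (exists_mul' hS a b).choose_spec,
    fun h => h ▸ (exists_mul' hS a b).choose_spec⟩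

variable (hS : S.IsWeakCategory 2)

lemma unit_triangleMul (a : X _⦋2⦌) : triangleMul hS (unitTriangle X) a = a :=
  (isTetrahedron_mul_iff hS).1 (isTetrahedron_σ_zero a)

lemma triangleMul_unit (a : X _⦋2⦌) : triangleMul hS a (unitTriangle X) = a :=
  (isTetrahedron_mul_iff hS).1 (isTetrahedron_σ_one a)

lemma triangleMul'_unit (a : X _⦋2⦌) : triangleMul' hS a (unitTriangle X) = a :=
  (isTetrahedron_mul'_iff hS).1 (isTetrahedron_σ_one a)

lemma unit_triangleMul' (a : X _⦋2⦌) : triangleMul' hS (unitTriangle X) a = a :=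
  (isTetrahedron_mul'_iff hS).1 (isTetrahedron_σ_two a)

/-- Four triangles bound a tetrahedron if and only if their composites agree. -/
lemma isTetrahedron_iff {a₀ a₁ a₂ a₃ : X _⦋2⦌} :
    IsTetrahedron a₀ a₁ a₂ a₃ ↔ triangleMul hS a₂ a₀ = triangleMul' hS a₁ a₃ := by
  constructor
  · intro h
    -- The given tetrahedron is 0134 of a 4-simplex whose triangles 012, 123 and 234 are degenerate;
    -- the face 0234 then computes the second product. The converse reads the same 4-simplex
    -- backwards.
    exact ((isTetrahedron_mul'_iff hS).1 (isTetrahedron_of_pentagon_one hS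
      (isTetrahedron_σ_one a₀) h ((isTetrahedron_mul_iff hS).2 rfl)
      (isTetrahedron_σ_one a₃))).symm
  · intro h
    exact isTetrahedron_of_pentagon_two hS (isTetrahedron_σ_one a₀)
      ((isTetrahedron_mul'_iff hS).2 h.symm) ((isTetrahedron_mul_iff hS).2 rfl)
      (isTetrahedron_σ_one a₃)

/-- This is the tetrahedron 0134 of a 4-simplex with 123 degenerate, where 1234 forms the product of
`r` and `s` and 0123 that of `q` and `p`. Setting some variables to the unit yields associativity
and the comparison of the two products. -/
lemma triangleMul_eq_of_eq {p q r s t w y : X _⦋2⦌}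
    (h : triangleMul hS t r = triangleMul' hS w p) (h' : triangleMul hS w s = triangleMul' hS y q) :
    triangleMul hS t (triangleMul hS r s) = triangleMul' hS y (triangleMul' hS q p) :=
  (isTetrahedron_iff hS).1 (isTetrahedron_of_pentagon_two hS ((isTetrahedron_mul_iff hS).2 rfl)
    ((isTetrahedron_iff hS).2 h') ((isTetrahedron_iff hS).2 h) ((isTetrahedron_mul'_iff hS).2 rfl))

lemma triangleMul_assoc (a b c : X _⦋2⦌) :
    triangleMul hS (triangleMul hS a b) c = triangleMul hS a (triangleMul hS b c) := by
  rw [triangleMul_eq_of_eq hS (triangleMul'_unit hS _).symm (triangleMul'_unit hS _).symm,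
    triangleMul'_unit, triangleMul'_unit]

lemma triangleMul'_eq (a b : X _⦋2⦌) : triangleMul' hS a b = triangleMul hS b a := by
  have := triangleMul_eq_of_eq hS (p := b) (q := unitTriangle X) (r := b) (s := a)
    (t := unitTriangle X) (w := unitTriangle X) (y := a)
    (by rw [unit_triangleMul, unit_triangleMul']) (by rw [unit_triangleMul, triangleMul'_unit])
  rw [unit_triangleMul, unit_triangleMul'] at this
  exact this.symm

/-- In a 4-simplex with 012, 014, 034 trivial and 013, 134 equal to `a`, the triangle 023 is the
product of `a` and `b` and 234 that of `b` and `a`; the tetrahedron 0234 equates them. -/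
lemma triangleMul_comm (a b : X _⦋2⦌) : triangleMul hS a b = triangleMul hS b a := by
  have := isTetrahedron_of_pentagon_one hS (a₁₂₄ := unitTriangle X) (a₁₂₃ := b) (a₁₃₄ := a)
    (a₀₁₃ := a) (a₀₁₄ := unitTriangle X) (a₀₃₄ := unitTriangle X) (a₂₃₄ := triangleMul hS b a)
    ((isTetrahedron_iff hS).2 (by rw [unit_triangleMul, triangleMul'_eq]))
    ((isTetrahedron_iff hS).2 (by rw [unit_triangleMul, unit_triangleMul']))
    ((isTetrahedron_mul_iff hS).2 rfl) ((isTetrahedron_mul_iff hS).2 rfl)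
  rw [isTetrahedron_iff hS, unit_triangleMul, unit_triangleMul, unit_triangleMul'] at this
  exact this.symm

/-- The triangles of a doubly degenerate weak `2`-category form a commutative monoid. -/
noncomputable abbrev triangleCommMonoid : CommMonoid (X _⦋2⦌) where
  mul := triangleMul hS
  one := unitTriangle X
  mul_assoc := triangleMul_assoc hS
  one_mul := unit_triangleMul hS
  mul_one := triangleMul_unit hS
  mul_comm := triangleMul_comm hS

lemma triangleMul_δ (z : X _⦋3⦌) :
    triangleMul hS (X.δ 2 z) (X.δ 0 z) = triangleMul hS (X.δ 1 z) (X.δ 3 z) := by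
  rw [(isTetrahedron_iff hS).1 ⟨z, rfl, rfl, rfl, rfl⟩, triangleMul'_eq, triangleMul_comm]

end

/-! ### Inserting a vertex into a cocycle -/

section

open cocycleNerve

variable {M : Type u} [CommMonoid M] {n : ℕ}

/-- The cochain that separates the vertices `0` and `1` from the others by an additional
vertex `2`. -/
def insertVal (c : (cocycleNerve M) _⦋n + 4⦌) (i j k : Fin (n + 5)) : M :=
  if (i : ℕ) = 0 ∧ (j : ℕ) = 1 ∧ (k : ℕ) = 2 then 1
  else if (i : ℕ) = 0 ∧ (j : ℕ) = 2 ∧ 2 < (k : ℕ) then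
    triangleFun (val c) 0 1 2 * triangleFun (val c) i j k
  else triangleFun (val c) i j k

lemma mono_of_lt {α : ⦋2⦌ ⟶ ⦋n⦌} (h : α.toOrderHom 0 < α.toOrderHom 1)
    (h' : α.toOrderHom 1 < α.toOrderHom 2) : Mono α := by
  rw [SimplexCategory.mono_iff_injective]
  apply StrictMono.injective
  rw [Fin.strictMono_iff_lt_succ (n := 2)]
  intro i
  fin_cases i
  exacts [h, h']

lemma triangleFun_eq_one (c : (cocycleNerve M) _⦋n⦌) {i j k : Fin (n + 1)}
    (h : ¬ (i < j ∧ j < k)) : triangleFun (val c) i j k = 1 := by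
  by_cases h' : i ≤ j ∧ j ≤ k
  · rw [triangleFun_eq _ h'.1 h'.2, val_eq_one]
    intro hm
    have := strictMono_of_mono (SimplexCategory.mkOfLeComp i j k h'.1 h'.2)
    exact h ⟨this (a := (0 : Fin 3)) (b := (1 : Fin 3)) (by decide),
      this (a := (1 : Fin 3)) (b := (2 : Fin 3)) (by decide)⟩
  · exact dif_neg h'

lemma insertVal_eq_one (c : (cocycleNerve M) _⦋n + 4⦌) {i j k : Fin (n + 5)}
    (h : ¬ (i < j ∧ j < k)) : insertVal c i j k = 1 := by
  rw [insertVal, if_neg (by lia), if_neg (by lia), triangleFun_eq_one c h]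

/-- Over a group this would be the change by a coboundary supported on the edge 02: the value on 012
is moved across this edge to the triangles 02k. Setting the value on 012 to 1 outright avoids
inverses. -/
lemma triangleCocycle_insertVal (c : (cocycleNerve M) _⦋n + 4⦌) {i j k l : Fin (n + 5)}
    (hij : i < j) (hjk : j < k) (hkl : k < l)
    (h : TriangleCocycle (triangleFun (val c)) i j k l) :
    TriangleCocycle (insertVal c) i j k l := by
  rw [TriangleCocycle] at h ⊢
  simp only [insertVal]
  by_cases hi : (i : ℕ) = 0
  · obtain rfl : i = 0 := Fin.ext hi
    by_cases hj : (j : ℕ) = 1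
    · obtain rfl : j = 1 := Fin.ext (by simpa using hj)
      by_cases hk : (k : ℕ) = 2
      · obtain rfl : k = 2 := Fin.ext (hk.trans Fin.val_two.symm)
        have hl : (l : ℕ) ≠ 2 := by lia
        have hl' : 2 < (l : ℕ) := by lia
        simp [hl, hl', h, mul_comm]
      · have hl : (l : ℕ) ≠ 2 := by lia
        simp [hk, hl, h]
    · by_cases hj2 : (j : ℕ) = 2
      · have hk : 2 < (k : ℕ) := by lia
        have hl : 2 < (l : ℕ) := by lia
        have hk' : (k : ℕ) ≠ 2 := by lia
        have hk1 : (k : ℕ) ≠ 1 := by lia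
        simp [hj2, hk, hl, hk', hk1, mul_assoc, h, mul_left_comm]
      · have hk1 : (k : ℕ) ≠ 1 := by lia
        have hk2 : (k : ℕ) ≠ 2 := by lia
        simp [hj, hj2, hk1, hk2, h]
  · have hj : (j : ℕ) ≠ 0 := by lia
    simp [hi, hj, h]

/-- The cocycle with an additional vertex `2`. -/
def insertVertex (c : (cocycleNerve M) _⦋n + 3⦌) : (cocycleNerve M) _⦋n + 4⦌ :=
  let d : (cocycleNerve M) _⦋n + 4⦌ := (cocycleNerve M).map (SimplexCategory.σ 2).op c
  have h : ∀ α : ⦋2⦌ ⟶ ⦋n + 4⦌, ¬ Mono α →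
      insertVal d (α.toOrderHom 0) (α.toOrderHom 1) (α.toOrderHom 2) = 1 := fun α hα =>
    insertVal_eq_one d fun h => hα (mono_of_lt h.1 h.2)
  mk
    { val := fun α => insertVal d (α.toOrderHom 0) (α.toOrderHom 1) (α.toOrderHom 2)
      val_eq_one := h
      val_mul_val := fun τ => by
        by_cases hτ : Mono τ
        · have := strictMono_of_mono τ
          exact triangleCocycle_insertVal d (this (a := (0 : Fin 4)) (b := (1 : Fin 4)) (by decide))
            (this (a := (1 : Fin 4)) (b := (2 : Fin 4)) (by decide))
            (this (a := (2 : Fin 4)) (b := (3 : Fin 4)) (by decide))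
            ((triangleCocycle_triangleFun_iff _ τ).2 (val_mul_val d τ))
        · exact mul_val_eq_of_not_mono (fun α : ⦋2⦌ ⟶ ⦋n + 4⦌ =>
            insertVal d (α.toOrderHom 0) (α.toOrderHom 1) (α.toOrderHom 2)) h τ hτ }

lemma val_insertVertex (c : (cocycleNerve M) _⦋n + 3⦌) (α : ⦋2⦌ ⟶ ⦋n + 4⦌) :
    val (insertVertex c) α = insertVal ((cocycleNerve M).map (SimplexCategory.σ 2).op c)
      (α.toOrderHom 0) (α.toOrderHom 1) (α.toOrderHom 2) := rfl

lemma val_insertVertex_of_ne (c : (cocycleNerve M) _⦋n + 3⦌) (α : ⦋2⦌ ⟶ ⦋n + 4⦌)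
    (h : ¬ ((α.toOrderHom 0 : ℕ) = 0 ∧ (α.toOrderHom 1 : ℕ) = 1 ∧ (α.toOrderHom 2 : ℕ) = 2))
    (h' : ¬ ((α.toOrderHom 0 : ℕ) = 0 ∧ (α.toOrderHom 1 : ℕ) = 2)) :
    val (insertVertex c) α = val c (α ≫ SimplexCategory.σ 2) := by
  rw [val_insertVertex, insertVal, if_neg h, if_neg (by tauto), ← eq_triangleFun, val_map]

lemma δ_insertVertex (c : (cocycleNerve M) _⦋n + 3⦌) :
    (cocycleNerve M).δ 2 (insertVertex c) = c := by
  refine ext fun α => ?_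
  have key (l : Fin 3) : ((α ≫ SimplexCategory.δ (2 : Fin (n + 5))).toOrderHom l : ℕ) ≠ 2 :=
    fun h => Fin.succAbove_ne (2 : Fin (n + 5)) (α.toOrderHom l) (Fin.ext (h.trans Fin.val_two.symm))
  rw [val_δ, val_insertVertex_of_ne _ _ (fun h => key 2 h.2.2) (fun h => key 1 h.2),
    Category.assoc, SimplexCategory.δ_comp_σ_self' (by rfl), Category.comp_id]

/-- The triangle at an inner vertex of a cocycle is trivial. -/
def TrivialAt (k : ℕ) (c : (cocycleNerve M) _⦋n⦌) : Prop :=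
  ∀ α : ⦋2⦌ ⟶ ⦋n⦌, (α.toOrderHom 0 : ℕ) = k → (α.toOrderHom 1 : ℕ) = k + 1 →
    (α.toOrderHom 2 : ℕ) = k + 2 → val c α = 1

lemma trivialAt_zero_insertVertex (c : (cocycleNerve M) _⦋n + 3⦌) :
    TrivialAt 0 (insertVertex c) := fun α h0 h1 h2 => by
  rw [val_insertVertex, insertVal, if_pos ⟨h0, h1, h2⟩]

lemma σ_val {n : ℕ} (i : Fin (n + 1)) (j : Fin (n + 2)) :
    ((SimplexCategory.σ i).toOrderHom j : ℕ) = if (j : ℕ) ≤ i then (j : ℕ) else j - 1 := by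
  change (i.predAbove j : ℕ) = _
  split_ifs with h
  · rw [Fin.predAbove_of_le_castSucc i j (by simpa [Fin.le_def] using h)]; simp
  · rw [Fin.predAbove_of_castSucc_lt i j (by simpa [Fin.lt_def] using h)]; simp

/-- The collapse `σ 2` identifies the vertices 2 and 3, so it degenerates 123, and likewise 234,
neither of which is altered by the modification. -/
lemma trivialAt_one_insertVertex (c : (cocycleNerve M) _⦋n + 3⦌) :
    TrivialAt 1 (insertVertex c) := fun α h0 h1 h2 => by
  rw [val_insertVertex_of_ne _ _ (by lia) (by lia), val_eq_one]
  intro hm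
  have := strictMono_of_mono (α ≫ SimplexCategory.σ 2) (a := (1 : Fin 3)) (b := (2 : Fin 3))
    (by decide)
  change (SimplexCategory.σ 2).toOrderHom (α.toOrderHom 1) <
    (SimplexCategory.σ 2).toOrderHom (α.toOrderHom 2) at this
  rw [Fin.lt_def, σ_val, σ_val, Fin.val_two] at this
  simp [h1, h2] at this

lemma trivialAt_two_insertVertex (c : (cocycleNerve M) _⦋n + 3⦌) :
    TrivialAt 2 (insertVertex c) := fun α h0 h1 h2 => by
  rw [val_insertVertex_of_ne _ _ (by lia) (by lia), val_eq_one]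
  intro hm
  have := strictMono_of_mono (α ≫ SimplexCategory.σ 2) (a := (0 : Fin 3)) (b := (1 : Fin 3))
    (by decide)
  change (SimplexCategory.σ 2).toOrderHom (α.toOrderHom 0) <
    (SimplexCategory.σ 2).toOrderHom (α.toOrderHom 1) at this
  rw [Fin.lt_def, σ_val, σ_val, Fin.val_two] at this
  simp [h1, h0] at this

lemma δ_val {n : ℕ} (i : Fin (n + 2)) (j : Fin (n + 1)) :
    ((SimplexCategory.δ i).toOrderHom j : ℕ) = if (j : ℕ) < i then (j : ℕ) else j + 1 := by
  change (i.succAbove j : ℕ) = _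
  simp only [Fin.succAbove, Fin.lt_def, Fin.val_castSucc]
  split_ifs <;> simp

lemma TrivialAt.δ_of_le {k : ℕ} {c : (cocycleNerve M) _⦋n + 1⦌} (h : TrivialAt (k + 1) c)
    {i : Fin (n + 2)} (hi : (i : ℕ) ≤ k) : TrivialAt k ((cocycleNerve M).δ i c) :=
  fun α h0 h1 h2 => h _ ((δ_val i _).trans (by rw [h0, if_neg (by lia)]))
    ((δ_val i _).trans (by rw [h1, if_neg (by lia)]))
    ((δ_val i _).trans (by rw [h2, if_neg (by lia)]))

lemma TrivialAt.δ_of_lt {k : ℕ} {c : (cocycleNerve M) _⦋n + 1⦌} (h : TrivialAt k c)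
    {i : Fin (n + 2)} (hi : k + 2 < (i : ℕ)) : TrivialAt k ((cocycleNerve M).δ i c) :=
  fun α h0 h1 h2 => h _ ((δ_val i _).trans (by rw [h0, if_pos (by lia)]))
    ((δ_val i _).trans (by rw [h1, if_pos (by lia)]))
    ((δ_val i _).trans (by rw [h2, if_pos (by lia)]))

/-- All faces but one of a cocycle with an additional vertex are trivial at some vertex. -/
lemma exists_trivialAt_δ_insertVertex (c : (cocycleNerve M) _⦋n + 3⦌) (i : Fin (n + 5))
    (hi : i ≠ 2) : ∃ k < 2, TrivialAt k ((cocycleNerve M).δ i (insertVertex c)) := by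
  have hi' : (i : ℕ) ≠ 2 := fun h => hi (Fin.ext (h.trans Fin.val_two.symm))
  obtain h | h | h : (i : ℕ) = 0 ∨ (i : ℕ) = 1 ∨ 2 < (i : ℕ) := by lia
  -- Deleting 0 or 1 keeps 123 or 234 and shifts its vertices down by one; deleting a vertex above 2
  -- keeps 012.
  · exact ⟨0, by lia, (trivialAt_one_insertVertex c).δ_of_le (by lia)⟩
  · exact ⟨1, by lia, (trivialAt_two_insertVertex c).δ_of_le (by lia)⟩
  · exact ⟨0, by lia, (trivialAt_zero_insertVertex c).δ_of_lt (by lia)⟩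

end

open cocycleNerve

lemma ContainsNeighbours.val_eq {n k : ℕ} (hk : k + 2 < n + 1) {α : ⦋2⦌ ⟶ ⦋n⦌}
    (h : ContainsNeighbours ⟨k + 1, by lia⟩ α) :
    (α.toOrderHom 0 : ℕ) = k ∧ (α.toOrderHom 1 : ℕ) = k + 1 ∧ (α.toOrderHom 2 : ℕ) = k + 2 := by
  obtain ⟨a, ha⟩ := h ⟨k, by lia⟩ (by simp +arith) (by simp)
  obtain ⟨b, hb⟩ := h ⟨k + 1, by lia⟩ (by simp) (by simp)
  obtain ⟨c, hc⟩ := h ⟨k + 2, by lia⟩ (by simp) (by simp)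
  change Fin 3 at a b c
  change α.toOrderHom a = _ at ha
  change α.toOrderHom b = _ at hb
  change α.toOrderHom c = _ at hc
  have hab : a < b := α.toOrderHom.monotone.reflect_lt (by rw [ha, hb]; simp [Fin.lt_def])
  have hbc : b < c := α.toOrderHom.monotone.reflect_lt (by rw [hb, hc]; simp [Fin.lt_def])
  obtain ⟨rfl, rfl, rfl⟩ : a = 0 ∧ b = 1 ∧ c = 2 := by lia
  exact ⟨congrArg Fin.val ha, congrArg Fin.val hb, congrArg Fin.val hc⟩

/-! ### The comparison with the nerve of the monoid of triangles -/

section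

variable {X : SSet.{u}} [Unique (X _⦋0⦌)] [Subsingleton (X _⦋1⦌)] [CommMonoid (X _⦋2⦌)]
  (h1 : unitTriangle X = 1)
  (hmul : ∀ z : X _⦋3⦌, X.δ 2 z * X.δ 0 z = X.δ 1 z * X.δ 3 z)

/-- The comparison map that sends a simplex to the cocycle of its triangles. -/
def toCocycleNerve : X ⟶ cocycleNerve (X _⦋2⦌) where
  app Δ := ↾fun x => mk
    { val := fun α => X.map α.op x
      val_eq_one := fun α hα => by
        rw [← h1]
        exact map_eq_unitTriangle (n := Δ.unop.len) x α hα
      val_mul_val := fun τ => by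
        have := hmul (X.map τ.op x)
        simp only [SimplicialObject.δ, map_op_comp] at this
        exact this }
  naturality Δ Δ' f := by
    ext x
    exact cocycleNerve.ext (Δ := Δ'.unop) fun α => map_op_comp α f.unop x

@[simp]
lemma val_toCocycleNerve {Δ : SimplexCategory} (x : X.obj (op Δ)) (α : ⦋2⦌ ⟶ Δ) :
    val ((toCocycleNerve h1 hmul).app (op Δ) x) α = X.map α.op x := rfl

lemma toCocycleNerve_map {Δ Δ' : SimplexCategory} (f : Δ ⟶ Δ') (x : X.obj (op Δ')) :
    (toCocycleNerve h1 hmul).app (op Δ) (X.map f.op x) =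
      (cocycleNerve (X _⦋2⦌)).map f.op ((toCocycleNerve h1 hmul).app (op Δ') x) :=
  NatTrans.naturality_apply _ _ _

lemma toCocycleNerve_δ {n : ℕ} (i : Fin (n + 2)) (x : X _⦋n + 1⦌) :
    (toCocycleNerve h1 hmul).app (op ⦋n⦌) (X.δ i x) =
      (cocycleNerve (X _⦋2⦌)).δ i ((toCocycleNerve h1 hmul).app (op ⦋n + 1⦌) x) :=
  toCocycleNerve_map h1 hmul _ _

variable {S : Hollowness X} (hS : S.IsWeakCategory 2)

include hS in
-- The only triangle containing the neighbours of `k + 1` is trivial, so the horn at that vertex is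
-- admissible and has a unique filler.
lemma eq_of_trivialAt {n k : ℕ} (hk : k + 2 < n + 4) {x x' : X _⦋n + 3⦌}
    (hx : TrivialAt k ((toCocycleNerve h1 hmul).app (op ⦋n + 3⦌) x))
    (h : ∀ i : Fin (n + 4), (i : ℕ) ≠ k + 1 → X.δ i x = X.δ i x') : x = x' := by
  refine hS.eq_of_faces (by lia) ⟨k + 1, by lia⟩ (fun i hi => h i fun h => hi (Fin.ext h))
    fun r α _ hα => ?_
  by_cases hr : r = 2
  · subst hr
    obtain ⟨h0, h2, h3⟩ := hα.val_eq hk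
    rw [← val_toCocycleNerve h1 hmul, hx α h0 h2 h3, ← h1]
    exact unitTriangle_mem_hollow S
  · exact mem_hollow_of_subsingleton hS r hα.ne_zero hr _

include hS in
/-- A cocycle that is trivial at a vertex lifts if the corresponding horn does. -/
lemma exists_lift_of_trivialAt {n k : ℕ} (hk : k + 2 < n + 4)
    {y : (cocycleNerve (X _⦋2⦌)) _⦋n + 3⦌} (hy : TrivialAt k y)
    (hinj : Function.Injective ((toCocycleNerve h1 hmul).app (op ⦋n + 1⦌)))
    (x : Fin (n + 4) → X _⦋n + 2⦌) (hx : ∀ i : Fin (n + 4), (i : ℕ) ≠ k + 1 →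
      (toCocycleNerve h1 hmul).app (op ⦋n + 2⦌) (x i) = (cocycleNerve (X _⦋2⦌)).δ i y) :
    ∃ z : X _⦋n + 3⦌, (∀ i : Fin (n + 4), (i : ℕ) ≠ k + 1 → X.δ i z = x i) ∧
      (toCocycleNerve h1 hmul).app (op ⦋n + 3⦌) z = y := by
  have hne {i : Fin (n + 4)} (hi : i ≠ ⟨k + 1, by lia⟩) : (i : ℕ) ≠ k + 1 :=
    fun h => hi (Fin.ext h)
  obtain ⟨z, hz⟩ := hS.exists_of_faces ⟨k + 1, by lia⟩ x (fun i j hi hj α β h => by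
      apply hinj
      rw [toCocycleNerve_map, toCocycleNerve_map, hx i (hne hi), hx j (hne hj), map_δ, map_δ, h])
    (fun i hi r β hβ => by
      by_cases hr : r = 2
      · subst hr
        obtain ⟨h0, h2, h3⟩ := hβ.val_eq hk
        rw [← val_toCocycleNerve h1 hmul, hx i (hne hi), val_δ, hy _ h0 h2 h3, ← h1]
        exact unitTriangle_mem_hollow S
      · exact mem_hollow_of_subsingleton hS r hβ.ne_zero hr _)
  refine ⟨z, fun i hi => hz i fun h => hi (congrArg Fin.val h), ?_⟩
  -- The image of `z` and `y` fill the same admissible horn in the nerve.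
  refine ((isWeakCategory_cocycleNerve _).eq_of_faces (by lia) ⟨k + 1, by lia⟩ (fun i hi => ?_)
    fun r α _ hα => ?_).symm
  · rw [← toCocycleNerve_δ, hz i hi, hx i (hne hi)]
  · by_cases hr : r = 2
    · subst hr
      obtain ⟨h0, h2, h3⟩ := hα.val_eq hk
      rw [mem_hollow_two, val_map, Category.id_comp, hy α h0 h2 h3]
      exact isUnit_one
    · exact mem_hollow_of_ne hα.ne_zero hr _

include hS in
-- All faces of `insertVertex y` except the one opposite to 2 lift, and uniquely so, because they
-- are trivial at some vertex. Filling the horn at vertex 2 of these lifts produces a lift of `y` as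
-- the missing face.
lemma bijective_toCocycleNerve_succ (n : ℕ)
    (hn : ∀ m ≤ n + 2, Function.Bijective ((toCocycleNerve h1 hmul).app (op ⦋m⦌))) :
    Function.Bijective ((toCocycleNerve h1 hmul).app (op ⦋n + 3⦌)) := by
  have hval {i : Fin (n + 5)} (hi : (i : ℕ) ≠ 2) : i ≠ 2 := fun h => hi (by rw [h, Fin.val_two])
  have lift (y : (cocycleNerve (X _⦋2⦌)) _⦋n + 3⦌) (i : Fin (n + 5)) (hi : i ≠ 2) :
      ∃ x, (toCocycleNerve h1 hmul).app (op ⦋n + 3⦌) x =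
        (cocycleNerve (X _⦋2⦌)).δ i (insertVertex y) := by
    obtain ⟨k, hk, h⟩ := exists_trivialAt_δ_insertVertex y i hi
    choose x hx using (hn (n + 2) le_rfl).2
    obtain ⟨z, -, hz⟩ := exists_lift_of_trivialAt h1 hmul hS (by lia) h (hn (n + 1) (by lia)).1
      (fun j => x ((cocycleNerve (X _⦋2⦌)).δ j _)) fun j _ => hx _
    exact ⟨z, hz⟩
  have key (x x' : X _⦋n + 3⦌) (i : Fin (n + 5)) (hi : i ≠ 2) (y)
      (hx : (toCocycleNerve h1 hmul).app (op ⦋n + 3⦌) x =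
        (cocycleNerve (X _⦋2⦌)).δ i (insertVertex y))
      (hx' : (toCocycleNerve h1 hmul).app (op ⦋n + 3⦌) x' =
        (cocycleNerve (X _⦋2⦌)).δ i (insertVertex y)) : x = x' := by
    obtain ⟨k, hk, h⟩ := exists_trivialAt_δ_insertVertex y i hi
    refine eq_of_trivialAt h1 hmul hS (k := k) (by lia) (hx ▸ h) fun j _ => ?_
    apply (hn (n + 2) le_rfl).1
    rw [toCocycleNerve_δ, toCocycleNerve_δ, hx, hx']
  have : Nonempty (X _⦋n + 3⦌) := ⟨X.map (SimplexCategory.const ⦋n + 3⦌ ⦋0⦌ 0).op default⟩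
  choose! x hx using lift
  constructor
  · intro w w' hw
    -- Any lift `v` of the cocycle can be completed to a lift of the enlarged cocycle with `v`
    -- opposite to vertex 2, by filling the horn at vertex 1 instead.
    have ext (v : X _⦋n + 3⦌) (hv : (toCocycleNerve h1 hmul).app (op ⦋n + 3⦌) v =
        (toCocycleNerve h1 hmul).app (op ⦋n + 3⦌) w) := by
      refine exists_lift_of_trivialAt h1 hmul hS (k := 0) (by lia)
        (trivialAt_zero_insertVertex ((toCocycleNerve h1 hmul).app (op ⦋n + 3⦌) w))
        (hn (n + 2) (by lia)).1 (Function.update (x ((toCocycleNerve h1 hmul).app (op ⦋n + 3⦌) w)) 2 v) fun i _ => ?_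
      by_cases hi : i = 2
      · subst hi
        rw [Function.update_self, hv, δ_insertVertex]
      · rw [Function.update_of_ne hi, hx _ i hi]
    obtain ⟨z, hz, hzw⟩ := ext w rfl
    obtain ⟨z', hz', hzw'⟩ := ext w' hw.symm
    have h2 : ((2 : Fin (n + 5)) : ℕ) ≠ 0 + 1 := by rw [Fin.val_two]; lia
    -- Both fillers agree on all faces other than 2: on face 1 by uniqueness of lifts, on the rest
    -- by construction. The horn at vertex 2 is admissible, so they coincide, and with them their
    -- faces `w` and `w'`.
    have : z = z' := by
      refine eq_of_trivialAt h1 hmul hS (k := 1) (by lia) (hzw ▸ trivialAt_one_insertVertex _)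
        fun i hi => ?_
      by_cases hi1 : (i : ℕ) = 1
      · refine key _ _ i (hval hi) ((toCocycleNerve h1 hmul).app (op ⦋n + 3⦌) w) ?_ ?_
        · rw [toCocycleNerve_δ, hzw]
        · rw [toCocycleNerve_δ, hzw']
      · rw [hz i hi1, hz' i hi1, Function.update_of_ne (hval hi), Function.update_of_ne (hval hi)]
    have hw2 := hz 2 h2
    have hw2' := hz' 2 h2
    rw [Function.update_self] at hw2 hw2'
    rw [← hw2, ← hw2', this]
  · intro y
    obtain ⟨z, -, hz⟩ := exists_lift_of_trivialAt h1 hmul hS (k := 1) (by lia)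
      (trivialAt_one_insertVertex y) (hn (n + 2) (by lia)).1 (x y) fun i hi => hx y i (hval hi)
    exact ⟨X.δ 2 z, by rw [toCocycleNerve_δ, hz, δ_insertVertex]⟩

include hS in
lemma bijective_toCocycleNerve (n : ℕ) :
    Function.Bijective ((toCocycleNerve h1 hmul).app (op ⦋n⦌)) := by
  induction n using Nat.strong_induction_on with
  | h n ih =>
    match n with
    | 0 => exact ⟨fun _ _ _ => Subsingleton.elim _ _, fun _ => ⟨default, Subsingleton.elim _ _⟩⟩
    | 1 =>
      exact ⟨fun _ _ _ => Subsingleton.elim _ _, fun _ => ⟨X.σ 0 default, Subsingleton.elim _ _⟩⟩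
    | 2 =>
      have h (x : X _⦋2⦌) : val ((toCocycleNerve h1 hmul).app (op ⦋2⦌) x) (𝟙 _) = x := by simp
      exact ⟨fun x y hxy => by rw [← h x, hxy, h y], fun c => ⟨val c (𝟙 _), ext_two (h _)⟩⟩
    | n + 3 => exact bijective_toCocycleNerve_succ h1 hmul hS n fun m hm => ih m (by lia)

include hS in
lemma isIso_toCocycleNerve : IsIso (toCocycleNerve h1 hmul) := by
  rw [NatTrans.isIso_iff_isIso_app]
  intro Δ
  rw [isIso_iff_bijective]
  exact bijective_toCocycleNerve h1 hmul hS Δ.unop.len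

end

/-! ### Hollowness under the comparison, and essential surjectivity -/

/-- The hollowness structure pulled back along a simplicial map. -/
def Hollowness.comap {X Y : SSet.{u}} (T : Hollowness Y) (F : X ⟶ Y) : Hollowness X where
  hollow m := F.app (op ⦋m⦌) ⁻¹' T.hollow m
  hollow_zero := by rw [T.hollow_zero, Set.preimage_empty]
  degenerate_subset m _ hx := T.degenerate_subset m (SSet.degenerate_app_apply hx F)

lemma Hollowness.IsComplicial.comap {X Y : SSet.{u}} {T : Hollowness Y} (hT : T.IsComplicial)
    (F : X ⟶ Y) [IsIso F] : (T.comap F).IsComplicial where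
  exists_filler {m k} f hf := by
    obtain ⟨y, hy, hy'⟩ := hT.exists_filler (f ≫ F) hf
    have h : F.app (op ⦋m + 1⦌) ((inv F).app (op ⦋m + 1⦌) y) = y := by
      rw [← NatTrans.comp_app_apply, IsIso.inv_hom_id]
      rfl
    refine ⟨(inv F).app _ y, ?_, ?_⟩
    · change F.app (op ⦋m + 1⦌) _ ∈ T.hollow (m + 1)
      rwa [h]
    · rw [Hollowness.IsFiller, ← cancel_mono F, Category.assoc, SSet.yonedaEquiv_symm_comp, h]
      exact hy'
  face_hollow {m} k x hx h := by
    have hδ (i : Fin (m + 2)) : F.app _ (X.δ i x) = Y.δ i (F.app _ x) :=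
      NatTrans.naturality_apply F _ x
    change F.app (op ⦋m⦌) (X.δ k x) ∈ T.hollow m
    rw [hδ]
    refine hT.face_hollow k _ (fun r α hα => ?_) fun i hi => ?_
    · rw [← NatTrans.naturality_apply F α.op x]
      exact hx r α hα
    · rw [← hδ]
      exact h i hi

/-- Hollow triangles have inverses, so the comparison preserves hollowness. The hollowness pulled
back from the nerve is thus a complicial enlargement of `S`, and saturation of `S` forces equality.
-/
lemma mem_hollow_iff_toCocycleNerve {X : SSet.{u}} [Unique (X _⦋0⦌)] [Subsingleton (X _⦋1⦌)]
    [CommMonoid (X _⦋2⦌)] (h1 : unitTriangle X = 1)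
    (hmul : ∀ z : X _⦋3⦌, X.δ 2 z * X.δ 0 z = X.δ 1 z * X.δ 3 z) {S : Hollowness X}
    (hS : S.IsWeakCategory 2) {m : ℕ} (x : X _⦋m⦌) :
    x ∈ S.hollow m ↔ (toCocycleNerve h1 hmul).app (op ⦋m⦌) x ∈
      (cocycleNerveHollowness (X _⦋2⦌)).hollow m := by
  have h (m : ℕ) (x : X _⦋m⦌) (hx : x ∈ S.hollow m) : (toCocycleNerve h1 hmul).app (op ⦋m⦌) x ∈
      (cocycleNerveHollowness (X _⦋2⦌)).hollow m := by
    obtain rfl | rfl | hm : m = 0 ∨ m = 2 ∨ m ≠ 0 ∧ m ≠ 2 := by lia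
    · rw [S.hollow_zero] at hx
      exact hx.elim
    · obtain ⟨z, hz1, hz2, hz3⟩ := hS.exists_inverse inferInstance
        (mem_hollow_of_subsingleton hS) hx (unitTriangle_mem_hollow S)
      have := hmul z
      rw [hz1, hz2, hz3, h1, mul_one] at this
      rw [mem_hollow_two, val_toCocycleNerve]
      simpa using IsUnit.of_mul_eq_one _ this
    · exact mem_hollow_of_ne hm.1 hm.2 _
  have := isIso_toCocycleNerve h1 hmul hS
  exact ⟨h m x, fun hx => hS.saturated _ ((isComplicial_cocycleNerve _).comap
    (toCocycleNerve h1 hmul)) (fun m x hx => h m x hx) m hx⟩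

/-- An isomorphism of simplicial sets that preserves and reflects hollow simplices. -/
noncomputable def isoOfMemHollowIff {X Y : HollowSSet.{u}} (F : X.toSSet ⟶ Y.toSSet) [IsIso F]
    (h : ∀ (m : ℕ) (x : X.toSSet _⦋m⦌),
      x ∈ X.hollowness.hollow m ↔ F.app (op ⦋m⦌) x ∈ Y.hollowness.hollow m) : X ≅ Y where
  hom := ⟨F, fun m x => (h m x).1⟩
  inv := ⟨inv F, fun m y hy => by
    rw [h, ← NatTrans.comp_app_apply, IsIso.inv_hom_id]
    exact hy⟩
  hom_inv_id := HollowSSet.Hom.ext (IsIso.hom_inv_id F)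
  inv_hom_id := HollowSSet.Hom.ext (IsIso.inv_hom_id F)

instance : cocycleNerveFunctor.{u}.EssSurj where
  mem_essImage Y := by
    obtain ⟨⟨X, S⟩, hS, ⟨x₀, -, h₀⟩, ⟨x₁, -, h₁⟩⟩ := Y
    let : Unique (X _⦋0⦌) := ⟨⟨x₀⟩, fun x => h₀ x trivial⟩
    have : Subsingleton (X _⦋1⦌) := ⟨fun x y => (h₁ x trivial).trans (h₁ y trivial).symm⟩
    let : CommMonoid (X _⦋2⦌) := triangleCommMonoid hS
    have := isIso_toCocycleNerve (X := X) rfl (triangleMul_δ hS) hS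
    exact ⟨CommMonCat.of (X _⦋2⦌), ⟨(ObjectProperty.isoMk _ (isoOfMemHollowIff
      (Y := ⟨cocycleNerve (X _⦋2⦌), cocycleNerveHollowness _⟩)
      (toCocycleNerve (X := X) rfl (triangleMul_δ hS))
      fun m x => mem_hollow_iff_toCocycleNerve rfl (triangleMul_δ hS) hS x)).symm⟩⟩

instance : cocycleNerveFunctor.{u}.IsEquivalence where

end Street

theorem mainTheorem8 :
    Nonempty (DoublyDegenerateStreetTwoCat.{u} ≌ CommMonCat.{u}) :=
  ⟨Street.cocycleNerveFunctor.asEquivalence.symm⟩
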